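/- A stable plane is a set $M$ of points together with a set $\mathcal L$ of subsets of $M$ with at least two points each, called lines, such that any two distinct points lie on exactly one common line, where $M$ and $\mathcal L$ carry locally compact Hausdorff topologies of positive dimension, joining two distinct points is continuous, intersecting two distinct lines is continuous with open domain of definition in $\mathcal L\times\mathcal L$, and there are four points no three of which are collinear. It is a topological projective plane if any two lines intersect. It is projectively embeddable if, up to a homeomorphism of $M$ onto its image, $M$ is an open subset of the point set $P$ of a topological projective plane $(P,\mathcal K)$ and $\mathcal L$ consists of the nonempty intersections $K\cap M$ with $K\in\mathcal K$. Two lines are parallel if they are equal or disjoint. A line $A$ is affine if every point not on $A$ lies on exactly one line disjoint from $A$, and biaffine if $A$ and all its parallels are affine. Call a stable plane with point set $\mathbb R^2$ (usual topology) special if every line is homeomorphic to $\mathbb R$; the $y$-axis $C$ is a line; there are lines not meeting $C$ and lines other than $C$ meeting $C$; the affine lines are precisely the lines other than $C$ that meet $C$; these lines are in fact biaffine, and the parallels of such a line are precisely its translates in the $y$-direction. Corollary. (i) Special stable planes exist: the following lines in $\mathbb R^2$ define one, when the line space carries the topology generated by the sets $\{L : L\cap U\neq\emptyset\}$ with $U\subseteq\mathbb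 R^2$ open: - the vertical lines $x=c$, $c\in\mathbb R$; - the curves $\{(x,y): x>0,\ y=\lambda\log x+c\}$ and the curves $\{(x,y): x<0,\ y=\lambda\log(-x)+c\}$, where $c,\lambda\in\mathbb R$, $|\lambda|\ge 1$; - the curves $y=\operatorname{sgn}(x)\,\sigma\log\bigl(1+\tfrac{|x|}{1-|\sigma|}\bigr)+t$, where $\sigma,t\in\mathbb R$, $|\sigma|<1$. (ii) The stable plane in (i) is not projectively embeddable. (iii) More generally, no special stable plane is projectively embeddable. -/

import Mathlib

open Set Topology

universe u v

/-- A set of points `M` together with a set of distinguished subsets of `M`, the lines,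
and a topology on the set of lines. -/
structure LineGeometry (M : Type u) where
  lines : Set (Set M)
  lineTopology : TopologicalSpace lines

namespace LineGeometry

instance {M : Type u} (G : LineGeometry M) : TopologicalSpace G.lines := G.lineTopology

/-- A locally compact (Hausdorff) space of positive topological dimension. In this class of
spaces the usual notions of dimension agree as to whether the dimension is positive. -/
def IsLocallyCompactPosDim (X : Type u) [TopologicalSpace X] : Prop :=
  T2Space X ∧ LocallyCompactSpace X ∧ 0 < smallInductiveDimension X

/-- The pairs of distinct points: the domain of the joining operation. -/
abbrev DistinctPairs (M : Type u) : Type u := {x : M × M // x.1 ≠ x.2}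

/-- The pairs of distinct intersecting lines: the domain of the intersection operation. -/
def meetDomain {M : Type u} (G : LineGeometry M) : Set (G.lines × G.lines) :=
  {x | x.1 ≠ x.2 ∧ ((x.1 : Set M) ∩ (x.2 : Set M)).Nonempty}

/-- Stable planes. By uniqueness of joining lines, the map `j` in `continuous_join` is necessarily
the joining operation, and `m` in `continuous_meet` is necessarily the intersection operation. -/
structure IsStablePlane {M : Type u} [TopologicalSpace M] (G : LineGeometry M) : Prop where
  /-- Lines have at least two points. -/
  nontrivial_of_mem : ∀ L ∈ G.lines, L.Nontrivial
  /-- Any two points are joined by a unique line. -/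
  existsUnique_line : ∀ p q : M, p ≠ q → ∃! L : Set M, L ∈ G.lines ∧ p ∈ L ∧ q ∈ L
  /-- The point space is locally compact of positive dimension. -/
  points_top : IsLocallyCompactPosDim M
  /-- The line space is locally compact of positive dimension. -/
  lines_top : IsLocallyCompactPosDim G.lines
  /-- Joining is continuous. -/
  continuous_join : ∃ j : DistinctPairs M → G.lines, Continuous j ∧
    ∀ x, x.1.1 ∈ (j x : Set M) ∧ x.1.2 ∈ (j x : Set M)
  /-- Intersection is continuous. -/
  continuous_meet : ∃ m : G.meetDomain → M, Continuous m ∧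
    ∀ x, m x ∈ (x.1.1 : Set M) ∧ m x ∈ (x.1.2 : Set M)
  /-- Stability of intersection. -/
  isOpen_meetDomain : IsOpen G.meetDomain
  /-- There is a quadrangle: four points, no three of which are on one line. -/
  exists_quadrangle : ∃ a : Fin 4 → M, Function.Injective a ∧
    ∀ i j k : Fin 4, i ≠ j → j ≠ k → i ≠ k →
      ∀ L ∈ G.lines, ¬ (a i ∈ L ∧ a j ∈ L ∧ a k ∈ L)

/-- A topological projective plane: a stable plane in which any two lines intersect. -/
structure IsProjectivePlane {M : Type u} [TopologicalSpace M] (G : LineGeometry M) : Prop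
    extends IsStablePlane G where
  inter_nonempty : ∀ K ∈ G.lines, ∀ L ∈ G.lines, (K ∩ L).Nonempty

/-- `(M, G)` is projectively embeddable: up to homeomorphism onto its image, `M` is an open subset
of the point space of a topological projective plane `(P, H)` and its lines are the nonempty
traces of the lines of `(P, H)`. -/
def IsProjectivelyEmbeddable {M : Type u} [TopologicalSpace M] (G : LineGeometry M) : Prop :=
  ∃ (P : Type v) (_ : TopologicalSpace P) (H : LineGeometry P) (e : M → P),
    H.IsProjectivePlane ∧ IsOpenEmbedding e ∧
    G.lines = {L : Set M | L.Nonempty ∧ ∃ K ∈ H.lines, L = e ⁻¹' K}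

/-- `K` is parallel to `L`: equal to `L` or disjoint from `L`. -/
def Parallel {M : Type u} (K L : Set M) : Prop := K = L ∨ Disjoint K L

/-- `A` is an affine line: through every point outside `A` there is exactly one line
disjoint from `A`. -/
def IsAffineLine {M : Type u} (G : LineGeometry M) (A : Set M) : Prop :=
  A ∈ G.lines ∧ ∀ p : M, p ∉ A → ∃! K : Set M, K ∈ G.lines ∧ p ∈ K ∧ Disjoint K A

/-- A biaffine line: an affine line all of whose parallels are affine. -/
def IsBiaffineLine {M : Type u} (G : LineGeometry M) (A : Set M) : Prop :=
  G.IsAffineLine A ∧ ∀ K ∈ G.lines, Parallel K A → G.IsAffineLine K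

end LineGeometry

namespace SpecialPlane

open LineGeometry

/-- The special line: the `y`-axis. -/
def yAxis : Set (ℝ × ℝ) := {p | p.1 = 0}

/-- The translate of a set by `t` in the `y`-direction. -/
def vTranslate (t : ℝ) (L : Set (ℝ × ℝ)) : Set (ℝ × ℝ) := (fun p => (p.1, p.2 + t)) '' L

/-- The description of the special plane: a stable plane on `ℝ²`, all of whose lines are
homeomorphic to `ℝ`. There are three types of lines: the `y`-axis `C`, lines not meeting `C`, and
further lines meeting `C`. Precisely those of the third type are affine; they are biaffine,
and their parallels are their translates in the `y`-direction. -/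
structure IsSpecial (G : LineGeometry (ℝ × ℝ)) : Prop where
  isStablePlane : G.IsStablePlane
  homeomorph_real : ∀ L ∈ G.lines, Nonempty (L ≃ₜ ℝ)
  yAxis_mem : yAxis ∈ G.lines
  exists_second_type : ∃ L ∈ G.lines, Disjoint L yAxis
  exists_third_type : ∃ L ∈ G.lines, L ≠ yAxis ∧ (L ∩ yAxis).Nonempty
  affine_iff : ∀ L ∈ G.lines, G.IsAffineLine L ↔ L ≠ yAxis ∧ (L ∩ yAxis).Nonempty
  biaffine : ∀ L ∈ G.lines, L ≠ yAxis → (L ∩ yAxis).Nonempty → G.IsBiaffineLine L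
  parallel_iff : ∀ L ∈ G.lines, L ≠ yAxis → (L ∩ yAxis).Nonempty →
    ∀ K : Set (ℝ × ℝ), (K ∈ G.lines ∧ Parallel K L) ↔ ∃ t : ℝ, K = vTranslate t L

/-- The vertical line `x = c`. For `c = 0` this is the `y`-axis. -/
def vertical (c : ℝ) : Set (ℝ × ℝ) := {p | p.1 = c}

/-- The curve `y = l log x + c` in the right half plane. -/
def rightLog (l c : ℝ) : Set (ℝ × ℝ) := {p | 0 < p.1 ∧ p.2 = l * Real.log p.1 + c}

/-- The curve `y = l log (-x) + c` in the left half plane. -/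
def leftLog (l c : ℝ) : Set (ℝ × ℝ) := {p | p.1 < 0 ∧ p.2 = l * Real.log (-p.1) + c}

/-- The graph of `y = sgn(x) s log (1 + |x| / (1 - |s|)) + t` over the whole `x`-axis
(used for `|s| < 1`). -/
def graphLine (s t : ℝ) : Set (ℝ × ℝ) :=
  {p | p.2 = SignType.sign p.1 * (s * Real.log (1 + |p.1| / (1 - |s|))) + t}

/-- The lines of the special plane. -/
def specialLines : Set (Set (ℝ × ℝ)) :=
  {L | (∃ c, L = vertical c) ∨
    (∃ l c, 1 ≤ |l| ∧ (L = rightLog l c ∨ L = leftLog l c)) ∨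
    (∃ s t, |s| < 1 ∧ L = graphLine s t)}

/-- The special plane. A set of lines is open when it is a union of finite intersections of sets
`{L | L meets U}`, with `U` an open set of points. (In a stable plane this is always the topology
of the line space, because joining is continuous and intersection is stable.) -/
def specialPlane : LineGeometry (ℝ × ℝ) where
  lines := specialLines
  lineTopology := TopologicalSpace.generateFrom
    {W | ∃ U : Set (ℝ × ℝ), IsOpen U ∧ W = {L : specialLines | ((L : Set (ℝ × ℝ)) ∩ U).Nonempty}}

end SpecialPlane

/-! Non-embeddability comes from counting points at infinity. Suppose a special plane lies in a
projective plane. If the extension of a line `A` has a point `z` at infinity and `p` is off `A`, the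
line `pz` traces a parallel of `A` through `p`. So an affine line has at most one point at infinity.
The axis meets some line only at infinity and is not affine, hence has at least two such points,
`q₁` and `q₂`. An affine line `A` has exactly one, `x`, which it shares with its translates. The
line `xqᵢ` misses the embedded plane: the parallel of `A` through an embedded point of it would be
its trace, although a translate of `A` meets the axis at an embedded point and not at `qᵢ`. A second
affine line through the point of `A` on the axis has its only point at infinity `y ≠ x` on both
`xq₁` and `xq₂`. These lines therefore coincide with each other and then with the axis, which does
not miss the embedded plane.

For the example, put `m(s) = max (1 - |s|) 0`. Right of the axis the traces of the nonvertical lines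
are the vertical translates of `y = s log (m(s) + x)`, where `|s| < 1` gives graph lines and `|s| ≥
1` log curves; a point reflection gives the left side. The rise of such a function over an interval
is strictly increasing in `s` (`rightFun_sub_lt`, `fullFun_sub_strictMonoOn`) and takes every real
value, so points with distinct abscissae have exactly one joining line.

The same monotonicity makes the parameters of a line depend continuously on two of its points, and
makes noncollinearity an open condition (`eventually_not_onLine`). Joining is then an open quotient
map, which equips the line space with its Hausdorff and local compactness properties. Distinct lines
change sides where they meet, so nearby lines still meet (`eventually_inter`). Finally, a graph line
grows like `s log |x|` in absolute terms up to sign and a constant, hence meets all lines but its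
own translates, whereas a line in a closed half plane is missed by several lines through one point
of the opposite side. -/

namespace LineGeometry

theorem IsStablePlane.line_eq {M : Type u} [TopologicalSpace M] {G : LineGeometry M}
    (hG : G.IsStablePlane) {K L : Set M} (hK : K ∈ G.lines) (hL : L ∈ G.lines) {p q : M}
    (hpq : p ≠ q) (hpK : p ∈ K) (hqK : q ∈ K) (hpL : p ∈ L) (hqL : q ∈ L) : K = L :=
  (hG.existsUnique_line p q hpq).unique ⟨hK, hpK, hqK⟩ ⟨hL, hpL, hqL⟩

theorem IsStablePlane.point_eq {M : Type u} [TopologicalSpace M] {G : LineGeometry M}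
    (hG : G.IsStablePlane) {K L : Set M} (hK : K ∈ G.lines) (hL : L ∈ G.lines) (hKL : K ≠ L)
    {p q : M} (hpK : p ∈ K) (hqK : q ∈ K) (hpL : p ∈ L) (hqL : q ∈ L) : p = q := by
  by_contra h
  exact hKL (hG.line_eq hK hL h hpK hqK hpL hqL)

/-! ### Points at infinity in a projective extension -/

section Embedding

variable {M : Type u} {P : Type v} [TopologicalSpace M] [TopologicalSpace P]
  {G : LineGeometry M} {H : LineGeometry P} {e : M → P}

/-- A line of the subplane determines its extension. -/
theorem extension_unique (hG : G.IsStablePlane) (hH : H.IsStablePlane)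
    (he : Function.Injective e) {K K' : Set P} (hK : K ∈ H.lines) (hK' : K' ∈ H.lines)
    (hL : e ⁻¹' K ∈ G.lines) (h : e ⁻¹' K = e ⁻¹' K') : K = K' := by
  obtain ⟨p, hp, q, hq, hpq⟩ := hG.nontrivial_of_mem _ hL
  have hp' : p ∈ e ⁻¹' K' := h ▸ hp
  have hq' : q ∈ e ⁻¹' K' := h ▸ hq
  exact hH.line_eq hK hK' (he.ne hpq) hp hq hp' hq'

/-- The extension of an affine line has at most one point outside the embedded plane. -/
theorem IsAffineLine.point_at_infinity_unique (hG : G.IsStablePlane) (hH : H.IsStablePlane)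
    (he : Function.Injective e)
    (hlines : G.lines = {L : Set M | L.Nonempty ∧ ∃ K ∈ H.lines, L = e ⁻¹' K})
    {K : Set P} (hK : K ∈ H.lines) (hA : G.IsAffineLine (e ⁻¹' K)) {p : M} (hp : e p ∉ K)
    {x y : P} (hx : x ∈ K) (hy : y ∈ K) (hx' : x ∉ range e) (hy' : y ∉ range e) : x = y := by
  -- The line joining `e p` to a point `z` at infinity of `K` meets `K` only in `z`, so its trace is
  -- a line through `p` disjoint from the trace of `K`; affinity allows only one.
  have key : ∀ z ∈ K, z ∉ range e → ∃ J ∈ H.lines, e p ∈ J ∧ z ∈ J ∧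
      (e ⁻¹' J ∈ G.lines ∧ p ∈ e ⁻¹' J ∧ Disjoint (e ⁻¹' J) (e ⁻¹' K)) := by
    intro z hz hz'
    have hne : e p ≠ z := fun h => hz' ⟨p, h⟩
    obtain ⟨J, ⟨hJ, hpJ, hzJ⟩, -⟩ := hH.existsUnique_line _ _ hne
    refine ⟨J, hJ, hpJ, hzJ, ?_, hpJ, ?_⟩
    · rw [hlines]
      exact ⟨⟨p, hpJ⟩, J, hJ, rfl⟩
    · rw [Set.disjoint_left]
      intro w hwJ hwK
      have hJK : J ≠ K := fun h => hp (h ▸ hpJ)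
      exact hz' ⟨w, hH.point_eq hJ hK hJK hwJ hzJ hwK hz⟩
  obtain ⟨J₁, hJ₁, hp₁, hx₁, h₁⟩ := key x hx hx'
  obtain ⟨J₂, hJ₂, hp₂, hy₂, h₂⟩ := key y hy hy'
  have hJ : J₁ = J₂ := extension_unique hG hH he hJ₁ hJ₂ h₁.1 ((hA.2 p hp).unique h₁ h₂)
  subst hJ
  exact hH.point_eq hJ₁ hK (fun h => hp (h ▸ hp₁)) hx₁ hy₂ hx hy

end Embedding

/-- Disjoint lines of the embedded plane meet outside of it. -/
theorem exists_inter_of_disjoint {M : Type u} {P : Type v} [TopologicalSpace P]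
    {H : LineGeometry P} {e : M → P} (hH : H.IsProjectivePlane) {K K' : Set P}
    (hK : K ∈ H.lines) (hK' : K' ∈ H.lines) (h : Disjoint (e ⁻¹' K) (e ⁻¹' K')) :
    ∃ x ∈ K, x ∈ K' ∧ x ∉ range e := by
  obtain ⟨x, hx, hx'⟩ := hH.inter_nonempty K hK K' hK'
  refine ⟨x, hx, hx', ?_⟩
  rintro ⟨z, rfl⟩
  exact Set.disjoint_left.1 h hx hx'

end LineGeometry

/-! ### Non-embeddability of special planes -/

namespace SpecialPlane

open LineGeometry

/-- Through every point of the `y`-axis there are two affine lines. -/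
theorem IsSpecial.exists_ne_third {G : LineGeometry (ℝ × ℝ)} (hG : IsSpecial G)
    {A : Set (ℝ × ℝ)} (hA : A ∈ G.lines) (hAC : A ≠ yAxis) {c : ℝ × ℝ} (hcA : c ∈ A)
    (hc : c ∈ yAxis) : ∃ B ∈ G.lines, B ≠ yAxis ∧ c ∈ B ∧ B ≠ A := by
  have hc0 : c.1 = 0 := hc
  have key : ∀ y : ℝ, ∃ B ∈ G.lines, B ≠ yAxis ∧ c ∈ B ∧ ((1 : ℝ), y) ∈ B := by
    intro y
    have hne : c ≠ ((1 : ℝ), y) := by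
      rintro rfl
      norm_num at hc0
    obtain ⟨B, ⟨hB, hcB, hyB⟩, -⟩ := hG.isStablePlane.existsUnique_line _ _ hne
    refine ⟨B, hB, ?_, hcB, hyB⟩
    rintro rfl
    simp [yAxis] at hyB
  obtain ⟨B₀, hB₀, hC₀, hc₀, h₀⟩ := key 0
  obtain ⟨B₁, hB₁, hC₁, hc₁, h₁⟩ := key 1
  by_cases hBA₀ : B₀ = A
  swap
  · exact ⟨B₀, hB₀, hC₀, hc₀, hBA₀⟩
  by_cases hBA₁ : B₁ = A
  swap
  · exact ⟨B₁, hB₁, hC₁, hc₁, hBA₁⟩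
  -- Otherwise `A` contains `(1, 0)` and `(1, 1)`, so it meets its translate by `1` and, being
  -- parallel to it, equals it. Then `A` contains two points of the axis.
  exfalso
  subst hBA₀ hBA₁
  have h := (hG.parallel_iff _ hA hAC ⟨c, hcA, hc⟩ (vTranslate 1 B₁)).2 ⟨1, rfl⟩
  have h1 : ((1 : ℝ), (1 : ℝ)) ∈ vTranslate 1 B₁ := ⟨_, h₀, by simp⟩
  have h2 : (c.1, c.2 + 1) ∈ vTranslate 1 B₁ := ⟨c, hcA, rfl⟩
  have heq : vTranslate 1 B₁ = B₁ := by
    rcases h.2 with h' | h'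
    · exact h'
    · exact (Set.disjoint_left.1 h' h1 h₁).elim
  rw [heq] at h2
  have hne : c ≠ (c.1, c.2 + 1) := by
    intro h
    have := congrArg Prod.snd h
    simp at this
  exact hAC (hG.isStablePlane.line_eq hA hG.yAxis_mem hne hcA h2 hc hc0)

theorem IsSpecial.not_isProjectivelyEmbeddable {G : LineGeometry (ℝ × ℝ)} (hG : IsSpecial G) :
    ¬ IsProjectivelyEmbeddable.{0, v} G := by
  rintro ⟨P, _, H, e, hH, he, hlines⟩
  have hS := hG.isStablePlane
  have hT := hH.toIsStablePlane
  have hinj := he.injective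
  have ext : ∀ L ∈ G.lines, ∃ K ∈ H.lines, L = e ⁻¹' K := by
    intro L hL
    rw [hlines] at hL
    exact hL.2
  have trace : ∀ K ∈ H.lines, ∀ p, e p ∈ K → e ⁻¹' K ∈ G.lines := by
    intro K hK p hp
    rw [hlines]
    exact ⟨⟨p, hp⟩, K, hK, rfl⟩
  obtain ⟨C, hC, hCy⟩ := ext _ hG.yAxis_mem
  -- two points of the axis outside the embedded plane
  obtain ⟨q₁, q₂, hq, hq₁C, hq₂C, hq₁, hq₂⟩ : ∃ q₁ q₂, q₁ ≠ q₂ ∧ q₁ ∈ C ∧ q₂ ∈ C ∧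
      q₁ ∉ range e ∧ q₂ ∉ range e := by
    obtain ⟨L, hL, hLC⟩ := hG.exists_second_type
    obtain ⟨K, hK, rfl⟩ := ext L hL
    obtain ⟨q, hqK, hqC, hq⟩ := exists_inter_of_disjoint hH hK hC (hCy ▸ hLC)
    have hna : ¬ G.IsAffineLine yAxis := by
      rw [hG.affine_iff _ hG.yAxis_mem]
      exact fun h => h.1 rfl
    -- If `q` were the only point at infinity of the axis, the join of `p` and `q` would trace the
    -- only line through `p` disjoint from the axis, which would then be affine.
    by_contra hcon
    push Not at hcon
    refine hna ⟨hG.yAxis_mem, fun p hp => ?_⟩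
    have hpC : e p ∉ C := by
      rw [hCy] at hp
      exact hp
    have hne : e p ≠ q := fun h => hq ⟨p, h⟩
    obtain ⟨J, ⟨hJ, hpJ, hqJ⟩, hJu⟩ := hT.existsUnique_line _ _ hne
    refine ⟨e ⁻¹' J, ⟨trace J hJ p hpJ, hpJ, ?_⟩, ?_⟩
    · rw [hCy, Set.disjoint_left]
      intro w hwJ hwC
      exact hq ⟨w, hT.point_eq hJ hC (fun h => hpC (h ▸ hpJ)) hwJ hqJ hwC hqC⟩
    · rintro T ⟨hT', hpT, hTC⟩
      obtain ⟨K', hK', rfl⟩ := ext T hT'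
      obtain ⟨q', hq'K, hq'C, hq'⟩ := exists_inter_of_disjoint hH hK' hC (hCy ▸ hTC)
      have : q = q' := by
        by_contra hqq
        exact hq' (hcon q q' hqq hqC hq'C hq)
      subst this
      rw [hJu K' ⟨hK', hpT, hq'K⟩]
  obtain ⟨A, hA, hAC, c, hcA, hcC⟩ := hG.exists_third_type
  obtain ⟨K, hK, rfl⟩ := ext A hA
  have hcC' : e c ∈ C := by
    rw [hCy] at hcC
    exact hcC
  -- extensions of third type lines meet the axis in the embedded plane only
  have hmeet : ∀ J ∈ H.lines, e ⁻¹' J ≠ yAxis → ∀ d ∈ e ⁻¹' J, d ∈ yAxis →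
      ∀ q ∈ C, q ∉ range e → q ∉ J := by
    intro J hJ hJC d hdJ hdC q hqC hq' hqJ
    rw [hCy] at hdC hJC
    exact hq' ⟨d, hT.point_eq hJ hC (fun h => hJC (by rw [h])) hdJ hqJ hdC hqC⟩
  -- extensions of third type lines have at most one point outside the embedded plane
  have hinf : ∀ J ∈ H.lines, e ⁻¹' J ∈ G.lines → e ⁻¹' J ≠ yAxis → (e ⁻¹' J ∩ yAxis).Nonempty →
      ∀ x ∈ J, ∀ y ∈ J, x ∉ range e → y ∉ range e → x = y := by
    intro J hJ hJG hJC hJn x hx y hy hx' hy'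
    obtain ⟨p, hp⟩ : ∃ p, p ∉ e ⁻¹' J := by
      by_contra hall
      push Not at hall
      exact hJC (hS.line_eq hJG hG.yAxis_mem (p := (0, 0)) (q := (0, 1)) (by simp)
        (hall _) (hall _) rfl rfl)
    exact IsAffineLine.point_at_infinity_unique hS hT hinj hlines hJ
      ((hG.affine_iff _ hJG).2 ⟨hJC, hJn⟩) hp hx hy hx' hy'
  obtain ⟨x, hxK, hx⟩ : ∃ x ∈ K, x ∉ range e := by
    -- A translate of `A` differs from `A`, since otherwise `A` would contain two points of the
    -- axis. So it is disjoint from `A`, and the two extensions meet at infinity.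
    have h := (hG.parallel_iff _ hA hAC ⟨c, hcA, hcC⟩ (vTranslate 1 (e ⁻¹' K))).2 ⟨1, rfl⟩
    have hne : vTranslate 1 (e ⁻¹' K) ≠ e ⁻¹' K := by
      intro heq
      have h2 : (c.1, c.2 + 1) ∈ e ⁻¹' K := heq ▸ ⟨c, hcA, rfl⟩
      refine hAC (hS.line_eq hA hG.yAxis_mem (p := c) (q := (c.1, c.2 + 1)) ?_ hcA h2 hcC hcC)
      intro h
      have := congrArg Prod.snd h
      simp at this
    obtain ⟨K', hK', hKK'⟩ := ext _ h.1
    have hd := h.2.resolve_left hne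
    rw [hKK'] at hd
    obtain ⟨x, -, hx, hx'⟩ := exists_inter_of_disjoint hH hK' hK hd
    exact ⟨x, hx, hx'⟩
  have hxC : x ∉ C := fun h => hmeet K hK hAC c hcA hcC x h hx hxK
  -- the lines joining `x` to points of the axis at infinity miss the embedded plane
  have hempty : ∀ E ∈ H.lines, x ∈ E → ∀ q ∈ E, q ∈ C → q ∉ range e → ∀ p, e p ∉ E := by
    intro E hE hxE q hqE hqC hq' p hpE
    obtain ⟨B, hB, hpB, hBK⟩ : ∃ B ∈ G.lines, p ∈ B ∧ Parallel B (e ⁻¹' K) := by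
      by_cases hp : p ∈ e ⁻¹' K
      · exact ⟨_, hA, hp, Or.inl rfl⟩
      · obtain ⟨B, ⟨hB, hpB, hBK⟩, -⟩ :=
          ((hG.affine_iff _ hA).2 ⟨hAC, c, hcA, hcC⟩).2 p hp
        exact ⟨B, hB, hpB, Or.inr hBK⟩
    -- As a translate of `A`, the parallel through `p` meets the axis in an embedded point. Its
    -- extension also passes through `x`, so it is `E`, which would meet `C` a second time in `q`.
    obtain ⟨t, ht⟩ := (hG.parallel_iff _ hA hAC ⟨c, hcA, hcC⟩ B).1 ⟨hB, hBK⟩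
    have hdB : (c.1, c.2 + t) ∈ B := ht ▸ ⟨c, hcA, rfl⟩
    have hBC : B ≠ yAxis := by
      rcases hBK with h | h
      · rw [h]; exact hAC
      · rintro rfl
        exact Set.disjoint_left.1 h hcC hcA
    obtain ⟨J, hJ, rfl⟩ := ext B hB
    have hxJ : x ∈ J := by
      rcases hBK with h | h
      · rwa [extension_unique hS hT hinj hJ hK hB h]
      · obtain ⟨x', hxJ', hxK', hx'⟩ := exists_inter_of_disjoint hH hJ hK h
        rwa [hinf K hK hA hAC ⟨c, hcA, hcC⟩ x hxK x' hxK' hx hx']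
    have hJE : J = E := hT.line_eq hJ hE (p := x) (q := e p) (fun h => hx ⟨p, h.symm⟩)
      hxJ hpB hxE hpE
    exact hmeet J hJ hBC _ hdB hcC q hqC hq' (hJE ▸ hqE)
  obtain ⟨E₁, ⟨hE₁, hxE₁, hqE₁⟩, -⟩ := hT.existsUnique_line x q₁ (fun h => hxC (h ▸ hq₁C))
  obtain ⟨E₂, ⟨hE₂, hxE₂, hqE₂⟩, -⟩ := hT.existsUnique_line x q₂ (fun h => hxC (h ▸ hq₂C))
  have hM₁ := hempty E₁ hE₁ hxE₁ q₁ hqE₁ hq₁C hq₁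
  have hM₂ := hempty E₂ hE₂ hxE₂ q₂ hqE₂ hq₂C hq₂
  -- The extension of a second affine line through `c` meets `E₁` and `E₂` at infinity, hence in one
  -- common point, which is not `x` because `B ≠ A`.
  obtain ⟨B, hB, hBC, hcB, hBA⟩ := hG.exists_ne_third hA hAC hcA hcC
  obtain ⟨J, hJ, rfl⟩ := ext B hB
  obtain ⟨y₁, hy₁J, hy₁E⟩ := hH.inter_nonempty J hJ E₁ hE₁
  obtain ⟨y₂, hy₂J, hy₂E⟩ := hH.inter_nonempty J hJ E₂ hE₂
  have hy₁ : y₁ ∉ range e := by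
    rintro ⟨p, rfl⟩
    exact hM₁ p hy₁E
  have hy₂ : y₂ ∉ range e := by
    rintro ⟨p, rfl⟩
    exact hM₂ p hy₂E
  have hy : y₁ = y₂ := hinf J hJ hB hBC ⟨c, hcB, hcC⟩ y₁ hy₁J y₂ hy₂J hy₁ hy₂
  subst hy
  have hxy : x ≠ y₁ := by
    rintro rfl
    refine hBA ?_
    rw [hT.line_eq hJ hK (p := e c) (q := x) (fun h => hx ⟨c, h⟩) hcB hy₁J hcA hxK]
  have hEE : E₁ = E₂ := hT.line_eq hE₁ hE₂ hxy hxE₁ hy₁E hxE₂ hy₂E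
  have hEC : E₁ = C := hT.line_eq hE₁ hC hq hqE₁ (hEE ▸ hqE₂) hq₁C hq₂C
  exact hM₁ c (hEC ▸ hcC')

/-! ### The functions whose graphs are the lines -/

/-- The slope parameter `s` determines the shift `1 - |s|`, truncated at `0`. -/
noncomputable def margin (s : ℝ) : ℝ := max (1 - |s|) 0

/-- The traces on the right half plane of the nonvertical lines are the vertical translates of the
graphs of these functions. -/
noncomputable def rightFun (s x : ℝ) : ℝ := s * Real.log (margin s + x)

/-- The function of which `graphLine s 0` is the graph. -/
noncomputable def fullFun (s x : ℝ) : ℝ :=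
  SignType.sign x * (s * Real.log (1 + |x| / (1 - |s|)))

theorem margin_nonneg (s : ℝ) : 0 ≤ margin s := le_max_right _ _

@[simp] theorem margin_neg (s : ℝ) : margin (-s) = margin s := by simp [margin]

theorem margin_of_lt {s : ℝ} (hs : |s| < 1) : margin s = 1 - |s| :=
  max_eq_left (by linarith)

theorem margin_of_le {s : ℝ} (hs : 1 ≤ |s|) : margin s = 0 :=
  max_eq_right (by linarith)

theorem margin_pos {s : ℝ} (hs : |s| < 1) : 0 < margin s := by
  rw [margin_of_lt hs]
  linarith

theorem margin_le_margin {s s' : ℝ} (hs : 0 ≤ s) (h : s ≤ s') : margin s' ≤ margin s := by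
  unfold margin
  rw [abs_of_nonneg hs, abs_of_nonneg (hs.trans h)]
  exact max_le_max (by linarith) le_rfl

theorem continuous_margin : Continuous margin := by
  unfold margin
  fun_prop

@[simp] theorem rightFun_neg (s x : ℝ) : rightFun (-s) x = -rightFun s x := by
  simp [rightFun]

theorem log_sub_log_pos {a x₁ x₂ : ℝ} (hx : x₁ < x₂) (ha : 0 < a + x₁) :
    0 < Real.log (a + x₂) - Real.log (a + x₁) := by
  have := Real.log_lt_log ha (by linarith : a + x₁ < a + x₂)
  linarith

/-- Concavity of the logarithm: a larger shift means a smaller increment. -/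
theorem log_sub_log_le {a b x₁ x₂ : ℝ} (hba : b ≤ a) (hx : x₁ < x₂) (hb : 0 < b + x₁) :
    Real.log (a + x₂) - Real.log (a + x₁) ≤ Real.log (b + x₂) - Real.log (b + x₁) := by
  have h1 : 0 < a + x₁ := by linarith
  rw [← Real.log_div (by linarith) h1.ne', ← Real.log_div (by linarith) hb.ne']
  apply Real.log_le_log (div_pos (by linarith) h1)
  rw [div_le_div_iff₀ h1 hb]
  nlinarith

/-- Increments of the line functions are strictly increasing in the slope parameter. -/
theorem rightFun_sub_lt {x₁ x₂ s s' : ℝ} (hx : x₁ < x₂) (hs : s < s')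
    (h : 0 < margin s + x₁) (h' : 0 < margin s' + x₁) :
    rightFun s x₂ - rightFun s x₁ < rightFun s' x₂ - rightFun s' x₁ := by
  -- For nonnegative slopes both effects agree: the factor `s` grows, and the margin shrinks, which
  -- does not decrease the positive logarithmic increment. Oddness in `s` covers nonpositive slopes;
  -- slopes of opposite sign give increments of opposite sign.
  have base : ∀ {s s' : ℝ}, 0 ≤ s → s < s' → 0 < margin s' + x₁ →
      rightFun s x₂ - rightFun s x₁ < rightFun s' x₂ - rightFun s' x₁ := by
    intro s s' h0 hs h'
    have h1 := log_sub_log_le (margin_le_margin h0 hs.le) hx h'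
    have h2 := log_sub_log_pos hx h'
    unfold rightFun
    nlinarith
  rcases le_or_gt 0 s with h0 | h0
  · exact base h0 hs h'
  rcases le_or_gt s' 0 with h0' | h0'
  · have := base (s := -s') (s' := -s) (by linarith) (by linarith) (by simpa using h)
    simp only [rightFun_neg] at this
    linarith
  · have h1 := log_sub_log_pos hx h
    have h2 := log_sub_log_pos hx h'
    unfold rightFun
    nlinarith

theorem rightFun_sub_strictMono {x₁ x₂ : ℝ} (h₁ : 0 < x₁) (hx : x₁ < x₂) :
    StrictMono fun s => rightFun s x₂ - rightFun s x₁ := fun s s' hs =>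
  rightFun_sub_lt hx hs (add_pos_of_nonneg_of_pos (margin_nonneg s) h₁)
    (add_pos_of_nonneg_of_pos (margin_nonneg s') h₁)

/-- One formula for both signs of `x`, since one of the two logarithms is always `log (margin s)`.
It makes joint continuity and monotonicity visible across the axis. -/
theorem fullFun_eq {s : ℝ} (hs : |s| < 1) (x : ℝ) : fullFun s x =
    s * (Real.log (margin s + max x 0) - Real.log (margin s + max (-x) 0)) := by
  have hm := margin_pos hs
  have key : ∀ y : ℝ, 0 < y → Real.log (1 + y / margin s) =
      Real.log (margin s + y) - Real.log (margin s) := by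
    intro y hy
    rw [← Real.log_div (by linarith) hm.ne']
    congr 1
    field_simp
  unfold fullFun
  rw [← margin_of_lt hs]
  rcases lt_trichotomy x 0 with h | h | h
  · rw [sign_neg h, abs_of_neg h, max_eq_right h.le, max_eq_left (by linarith), key _ (by linarith)]
    simp
    ring
  · simp [h]
  · rw [sign_pos h, abs_of_pos h, max_eq_left h.le, max_eq_right (by linarith), key _ h]
    simp

@[simp] theorem fullFun_neg_left (s x : ℝ) : fullFun (-s) x = -fullFun s x := by
  simp [fullFun]

@[simp] theorem fullFun_neg_right (s x : ℝ) : fullFun s (-x) = -fullFun s x := by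
  simp [fullFun, Left.sign_neg]

@[simp] theorem fullFun_zero_right (s : ℝ) : fullFun s 0 = 0 := by simp [fullFun]

@[simp] theorem fullFun_zero_left (x : ℝ) : fullFun 0 x = 0 := by simp [fullFun]

/-- This places the right halves of the graph lines in the same family as the log curves. -/
theorem fullFun_of_nonneg {s x : ℝ} (hs : |s| < 1) (hx : 0 ≤ x) :
    fullFun s x = rightFun s x - s * Real.log (margin s) := by
  rw [fullFun_eq hs, max_eq_left hx, max_eq_right (by linarith), rightFun, add_zero]
  ring

theorem fullFun_of_nonpos {s x : ℝ} (hs : |s| < 1) (hx : x ≤ 0) :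
    fullFun s x = -rightFun s (-x) + s * Real.log (margin s) := by
  rw [← neg_neg x, fullFun_neg_right, fullFun_of_nonneg hs (by linarith), neg_neg]
  ring

/-- Right of the axis this is the statement for `rightFun`, and oddness in `x` gives the left side.
An interval straddling `0` is split there, where `fullFun` vanishes. -/
theorem fullFun_sub_strictMonoOn {x₁ x₂ : ℝ} (hx : x₁ < x₂) :
    StrictMonoOn (fun s => fullFun s x₂ - fullFun s x₁) (Ioo (-1) 1) := by
  have base : ∀ {x₁ x₂ : ℝ}, 0 ≤ x₁ → x₁ < x₂ → ∀ {s s' : ℝ}, |s| < 1 → |s'| < 1 → s < s' →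
      fullFun s x₂ - fullFun s x₁ < fullFun s' x₂ - fullFun s' x₁ := by
    intro x₁ x₂ h0 hx s s' hs hs' hss
    rw [fullFun_of_nonneg hs h0, fullFun_of_nonneg hs (h0.trans hx.le), fullFun_of_nonneg hs' h0,
      fullFun_of_nonneg hs' (h0.trans hx.le)]
    have := rightFun_sub_lt hx hss (add_pos_of_pos_of_nonneg (margin_pos hs) h0)
      (add_pos_of_pos_of_nonneg (margin_pos hs') h0)
    linarith
  intro s hs s' hs' hss
  have hs := abs_lt.2 hs
  have hs' := abs_lt.2 hs'
  show fullFun s x₂ - fullFun s x₁ < fullFun s' x₂ - fullFun s' x₁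
  rcases le_or_gt 0 x₁ with h1 | h1
  · exact base h1 hx hs hs' hss
  rcases le_or_gt x₂ 0 with h2 | h2
  · have := base (x₁ := -x₂) (x₂ := -x₁) (by linarith) (by linarith) hs hs' hss
    simp only [fullFun_neg_right] at this
    linarith
  · have a := base (x₁ := 0) (x₂ := -x₁) le_rfl (by linarith) hs hs' hss
    have b := base (x₁ := 0) (x₂ := x₂) le_rfl h2 hs hs' hss
    simp only [fullFun_neg_right, fullFun_zero_right] at a b
    linarith

theorem continuousOn_rightFun :
    ContinuousOn (fun z : ℝ × ℝ => rightFun z.1 z.2) (univ ×ˢ Ioi 0) := by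
  have := continuous_margin
  unfold rightFun
  refine continuousOn_fst.mul (ContinuousOn.log (by fun_prop) ?_)
  rintro ⟨s, x⟩ ⟨-, hx⟩
  exact (add_pos_of_nonneg_of_pos (margin_nonneg s) hx).ne'

theorem continuousOn_fullFun :
    ContinuousOn (fun z : ℝ × ℝ => fullFun z.1 z.2) (Ioo (-1) 1 ×ˢ univ) := by
  have := continuous_margin
  refine ContinuousOn.congr (f := fun z : ℝ × ℝ => z.1 * (Real.log (margin z.1 + max z.2 0) -
    Real.log (margin z.1 + max (-z.2) 0))) ?_ fun z hz => fullFun_eq (abs_lt.2 hz.1) z.2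
  refine continuousOn_fst.mul (ContinuousOn.sub (ContinuousOn.log (by fun_prop) ?_)
    (ContinuousOn.log (by fun_prop) ?_)) <;>
  · rintro ⟨s, x⟩ ⟨hs, -⟩
    exact (add_pos_of_pos_of_nonneg (margin_pos (abs_lt.2 hs)) (le_max_right _ _)).ne'

theorem continuous_fullFun {s : ℝ} (hs : |s| < 1) : Continuous (fullFun s) := by
  have : ContinuousOn (fun x => fullFun s x) univ :=
    continuousOn_fullFun.comp (f := fun x => (s, x)) (by fun_prop)
      fun x _ => ⟨abs_lt.1 hs, mem_univ _⟩
  exact continuousOn_univ.1 this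

theorem rightFun_monotoneOn {s : ℝ} (hs : 0 ≤ s) : MonotoneOn (rightFun s) (Ioi 0) := by
  intro x hx y hy hxy
  have hx' := add_pos_of_nonneg_of_pos (margin_nonneg s) hx
  exact mul_le_mul_of_nonneg_left (Real.log_le_log hx' (by linarith)) hs

theorem fullFun_monotone {s : ℝ} (hs : |s| < 1) (h0 : 0 ≤ s) : Monotone (fullFun s) := by
  intro x y hxy
  have hm := margin_pos hs
  rw [fullFun_eq hs, fullFun_eq hs]
  refine mul_le_mul_of_nonneg_left (sub_le_sub ?_ ?_) h0 <;> apply Real.log_le_log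
  · exact add_pos_of_pos_of_nonneg hm (le_max_right _ _)
  · gcongr
  · exact add_pos_of_pos_of_nonneg hm (le_max_right _ _)
  · gcongr

theorem exists_rightFun_sub_eq {x₁ x₂ : ℝ} (h₁ : 0 < x₁) (hx : x₁ < x₂) (d : ℝ) :
    ∃ s, rightFun s x₂ - rightFun s x₁ = d := by
  have hc : ∀ x : ℝ, 0 < x → Continuous fun s => rightFun s x := fun x hx =>
    continuousOn_univ.1 (continuousOn_rightFun.comp (f := fun s => (s, x)) (by fun_prop)
      fun s _ => ⟨mem_univ _, hx⟩)
  have hL : 0 < Real.log x₂ - Real.log x₁ := by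
    have := Real.log_lt_log h₁ hx
    linarith
  have key : ∀ d : ℝ, ∃ s, d ≤ rightFun s x₂ - rightFun s x₁ := by
    intro d
    -- Once `|s| ≥ 1` the margin is `0` and the increment is linear in `s`, hence unbounded.
    set T := max 1 (d / (Real.log x₂ - Real.log x₁))
    have hT : 1 ≤ T := le_max_left _ _
    refine ⟨T, ?_⟩
    rw [rightFun, rightFun, margin_of_le (by rwa [abs_of_pos (by linarith)]), zero_add, zero_add,
      ← mul_sub, ← div_le_iff₀ hL]
    exact le_max_right _ _
  obtain ⟨a, ha⟩ := key d
  obtain ⟨b, hb⟩ := key (-d)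
  refine mem_range_of_exists_le_of_exists_ge ((hc x₂ (h₁.trans hx)).sub (hc x₁ h₁))
    ⟨-b, ?_⟩ ⟨a, ha⟩
  simp only [rightFun_neg]
  linarith

theorem exists_le_fullFun {y : ℝ} (hy : 0 < y) (d : ℝ) :
    ∃ s, 0 ≤ s ∧ |s| < 1 ∧ d ≤ fullFun s y := by
  -- Here `b` is the margin of the slope `1 - b`. The bound `1 / 2` keeps the slope at least `1 /
  -- 2`, and the other bound makes the logarithm at least `2 * |d|`.
  set b := min (1 / 2) (y / Real.exp (2 * |d|)) with hb
  have hb0 : 0 < b := lt_min (by norm_num) (by positivity)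
  have hb1 : b ≤ 1 / 2 := min_le_left _ _
  have hs : |1 - b| = 1 - b := abs_of_pos (by linarith)
  refine ⟨1 - b, by linarith, by linarith, ?_⟩
  have h1 : 2 * |d| ≤ Real.log (1 + y / b) := by
    rw [Real.le_log_iff_exp_le (by positivity)]
    have : Real.exp (2 * |d|) ≤ y / b := by
      rw [le_div_iff₀ hb0, mul_comm, ← le_div_iff₀ (Real.exp_pos _)]
      exact min_le_right _ _
    linarith
  rw [fullFun, sign_pos hy, hs, abs_of_pos hy]
  have h2 := le_abs_self d
  have h3 := abs_nonneg d
  simp only [SignType.coe_one, one_mul, sub_sub_cancel]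
  nlinarith

/-- Slopes of modulus below `1` suffice for points not strictly on one side of the axis: the rise
from the axis blows up as the margin tends to `0`. -/
theorem exists_fullFun_sub_eq {x₁ x₂ : ℝ} (h₁ : x₁ ≤ 0) (h₂ : 0 ≤ x₂) (hx : x₁ < x₂) (d : ℝ) :
    ∃ s, |s| < 1 ∧ fullFun s x₂ - fullFun s x₁ = d := by
  have key : ∃ s, 0 ≤ s ∧ |s| < 1 ∧ |d| ≤ fullFun s x₂ - fullFun s x₁ := by
    rcases h₂.eq_or_lt with h | h
    · obtain ⟨s, h0, hs, hd⟩ := exists_le_fullFun (y := -x₁) (by linarith) |d|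
      refine ⟨s, h0, hs, ?_⟩
      rw [← h, fullFun_zero_right]
      simpa using hd
    · obtain ⟨s, h0, hs, hd⟩ := exists_le_fullFun h |d|
      have := fullFun_monotone hs h0 h₁
      rw [fullFun_zero_right] at this
      exact ⟨s, h0, hs, by linarith⟩
  obtain ⟨s, h0, hs, hd⟩ := key
  have hsub : Icc (-s) s ⊆ Ioo (-1) 1 := by
    intro r hr
    have := abs_lt.1 hs
    exact ⟨by linarith [hr.1], by linarith [hr.2]⟩
  have hc : ∀ x : ℝ, ContinuousOn (fun r => fullFun r x) (Icc (-s) s) := fun x =>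
    continuousOn_fullFun.comp (f := fun r => (r, x)) (by fun_prop)
      fun r hr => ⟨hsub hr, mem_univ _⟩
  have := abs_le.1 hd
  obtain ⟨r, hr, hrd⟩ := intermediate_value_Icc (by linarith) ((hc x₂).sub (hc x₁))
    (show d ∈ Icc _ _ by
      simp only [Pi.sub_apply, fullFun_neg_left]
      constructor <;> linarith [neg_abs_le d, le_abs_self d])
  exact ⟨r, abs_lt.2 (hsub hr), hrd⟩

/-- The growth rate `s log x` recovers the slope, so graph lines of different slopes diverge from
each other. -/
theorem tendsto_fullFun_sub_log {s : ℝ} (hs : |s| < 1) :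
    Filter.Tendsto (fun x => fullFun s x - s * Real.log x) Filter.atTop
      (𝓝 (-(s * Real.log (margin s)))) := by
  have h := ((Real.tendsto_log_comp_add_sub_log (margin s)).const_mul s).sub_const
    (s * Real.log (margin s))
  rw [mul_zero, zero_sub] at h
  refine h.congr' ?_
  filter_upwards [Filter.eventually_ge_atTop 0] with x hx
  rw [fullFun_of_nonneg hs hx, rightFun, add_comm x]
  ring

theorem exists_fullFun_sub_fullFun_eq {s s' : ℝ} (hs : |s| < 1) (hs' : |s'| < 1) (h : s ≠ s')
    (d : ℝ) : ∃ x, fullFun s' x - fullFun s x = d := by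
  wlog hlt : s < s' generalizing s s' d
  · obtain ⟨x, hx⟩ := this hs' hs h.symm (-d) (lt_of_le_of_ne (not_lt.1 hlt) h.symm)
    exact ⟨x, by linarith⟩
  have top : Filter.Tendsto (fun x => fullFun s' x - fullFun s x) Filter.atTop Filter.atTop := by
    have h1 := (tendsto_fullFun_sub_log hs').sub (tendsto_fullFun_sub_log hs)
    have h2 := Real.tendsto_log_atTop.const_mul_atTop (sub_pos.2 hlt)
    exact (h2.atTop_add h1).congr fun x => by ring
  have bot : Filter.Tendsto (fun x => fullFun s' x - fullFun s x) Filter.atBot Filter.atBot :=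
    (Filter.tendsto_neg_atTop_atBot.comp (top.comp Filter.tendsto_neg_atBot_atTop)).congr
      fun x => by simp only [Function.comp, fullFun_neg_right]; ring
  exact ((continuous_fullFun hs').sub (continuous_fullFun hs)).surjective top bot d

/-- With `x = exp u` and `l > 0`, the log curve tends to `-∞` at the axis while the graph line stays
bounded; far out the log curve wins because `s < 1 ≤ l`. -/
theorem exists_mul_log_sub_fullFun_eq {l s : ℝ} (hl : 1 ≤ |l|) (hs : |s| < 1) (d : ℝ) :
    ∃ x, 0 < x ∧ l * Real.log x - fullFun s x = d := by
  wlog hl0 : 0 < l generalizing l s d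
  · have hne : l ≠ 0 := by
      rintro rfl
      norm_num at hl
    obtain ⟨x, hx, h⟩ := this (l := -l) (s := -s) (by rwa [abs_neg]) (by rwa [abs_neg]) (-d)
      (by linarith [lt_of_le_of_ne (not_lt.1 hl0) hne])
    refine ⟨x, hx, ?_⟩
    rw [fullFun_neg_left] at h
    linarith
  have hsl : s < l := by
    rw [abs_of_pos hl0] at hl
    linarith [le_abs_self s]
  have top : Filter.Tendsto (fun u => l * u - fullFun s (Real.exp u)) Filter.atTop
      Filter.atTop := by
    have h1 := ((tendsto_fullFun_sub_log hs).comp Real.tendsto_exp_atTop).neg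
    have h2 := Filter.tendsto_id.const_mul_atTop (sub_pos.2 hsl)
    exact (h2.atTop_add h1).congr fun x => by simp; ring
  have bot : Filter.Tendsto (fun u => l * u - fullFun s (Real.exp u)) Filter.atBot
      Filter.atBot := by
    have h1 := (((continuous_fullFun hs).tendsto 0).comp Real.tendsto_exp_atBot).neg
    have h2 := Filter.tendsto_id.const_mul_atBot hl0
    exact (h2.atBot_add h1).congr fun x => by simp [sub_eq_add_neg]
  obtain ⟨u, hu⟩ := ((continuous_const.mul continuous_id).sub
    ((continuous_fullFun hs).comp Real.continuous_exp)).surjective top bot d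
  exact ⟨Real.exp u, Real.exp_pos u, by simpa using hu⟩

/-! ### Charts of the line space -/

/-- A parametrization of a set of nonvertical lines by the slope parameter and the intercept. Over
the domain of the chart, these lines are the vertical translates of the graphs of the functions
`fn s`. -/
structure LineChart where
  dom : Set ℝ
  slopes : Set ℝ
  fn : ℝ → ℝ → ℝ
  line : ℝ → ℝ → Set (ℝ × ℝ)
  isOpen_dom : IsOpen dom
  ordConnected_dom : dom.OrdConnected
  isOpen_slopes : IsOpen slopes
  continuousOn_fn : ContinuousOn (fun z : ℝ × ℝ => fn z.1 z.2) (slopes ×ˢ dom)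
  strictMonoOn_sub : ∀ x₁ ∈ dom, ∀ x₂ ∈ dom, x₁ < x₂ →
    StrictMonoOn (fun s => fn s x₂ - fn s x₁) slopes
  monotoneOn_or : ∀ s ∈ slopes, MonotoneOn (fn s) dom ∨ AntitoneOn (fn s) dom
  line_mem : ∀ s ∈ slopes, ∀ c, line s c ∈ specialLines
  mem_line : ∀ s ∈ slopes, ∀ c, ∀ x ∈ dom, ∀ y, (x, y) ∈ line s c ↔ y = fn s x + c

theorem mem_graphLine {s t x y : ℝ} : (x, y) ∈ graphLine s t ↔ y = fullFun s x + t := Iff.rfl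

theorem graphLine_mem {s : ℝ} (hs : |s| < 1) (t : ℝ) : graphLine s t ∈ specialLines :=
  Or.inr (Or.inr ⟨s, t, hs, rfl⟩)

theorem rightLog_mem {l : ℝ} (hl : 1 ≤ |l|) (c : ℝ) : rightLog l c ∈ specialLines :=
  Or.inr (Or.inl ⟨l, c, hl, Or.inl rfl⟩)

theorem leftLog_mem {l : ℝ} (hl : 1 ≤ |l|) (c : ℝ) : leftLog l c ∈ specialLines :=
  Or.inr (Or.inl ⟨l, c, hl, Or.inr rfl⟩)

theorem vertical_mem (c : ℝ) : vertical c ∈ specialLines := Or.inl ⟨c, rfl⟩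

/-- The chart of the nonvertical lines meeting the right half plane. -/
noncomputable def rightChart : LineChart where
  dom := Ioi 0
  slopes := univ
  fn := rightFun
  line s c := open Classical in
    -- The intercept absorbs the constant by which `fullFun s` and `rightFun s` differ.
    if |s| < 1 then graphLine s (c + s * Real.log (margin s)) else rightLog s c
  isOpen_dom := isOpen_Ioi
  ordConnected_dom := ordConnected_Ioi
  isOpen_slopes := isOpen_univ
  continuousOn_fn := continuousOn_rightFun
  strictMonoOn_sub _ h₁ _ _ h := (rightFun_sub_strictMono h₁ h).strictMonoOn _
  monotoneOn_or s _ := by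
    rcases le_total 0 s with h | h
    · exact Or.inl (rightFun_monotoneOn h)
    · right
      have := (rightFun_monotoneOn (neg_nonneg.2 h)).neg
      refine this.congr fun x _ => ?_
      simp
  line_mem s _ c := by
    split_ifs with h
    · exact graphLine_mem h _
    · exact rightLog_mem (not_lt.1 h) _
  mem_line s _ c x hx y := by
    have hx : 0 < x := hx
    split_ifs with h
    · rw [mem_graphLine, fullFun_of_nonneg h hx.le]
      ring_nf
    · simp [rightLog, rightFun, margin_of_le (not_lt.1 h), hx]

/-- The chart of the nonvertical lines meeting the left half plane. -/
noncomputable def leftChart : LineChart where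
  dom := Iio 0
  slopes := univ
  fn s x := -rightFun s (-x)
  line s c := open Classical in
    -- The slope of a left log curve changes sign so that increments from left to right increase
    -- with `s`, as they do for graph lines.
    if |s| < 1 then graphLine s (c - s * Real.log (margin s)) else leftLog (-s) c
  isOpen_dom := isOpen_Iio
  ordConnected_dom := ordConnected_Iio
  isOpen_slopes := isOpen_univ
  continuousOn_fn := (continuousOn_rightFun.comp (f := fun z : ℝ × ℝ => (z.1, -z.2))
    (by fun_prop) fun z hz => ⟨mem_univ _, mem_Ioi.2 (neg_pos.2 (mem_Iio.1 hz.2))⟩).neg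
  strictMonoOn_sub x₁ _ x₂ h₂ h s _ s' _ hs := by
    have := rightFun_sub_strictMono (neg_pos.2 h₂) (neg_lt_neg h) hs
    simp only at this ⊢
    linarith
  monotoneOn_or s _ := by
    rcases le_total 0 s with h | h
    · left
      intro x hx y hy hxy
      have := rightFun_monotoneOn h (mem_Ioi.2 (neg_pos.2 hy))
        (mem_Ioi.2 (neg_pos.2 hx)) (neg_le_neg hxy)
      linarith
    · right
      intro x hx y hy hxy
      have := rightFun_monotoneOn (neg_nonneg.2 h) (mem_Ioi.2 (neg_pos.2 hy))
        (mem_Ioi.2 (neg_pos.2 hx)) (neg_le_neg hxy)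
      simp only [rightFun_neg] at this
      linarith
  line_mem s _ c := by
    split_ifs with h
    · exact graphLine_mem h _
    · exact leftLog_mem (by simpa using h) _
  mem_line s _ c x hx y := by
    have hx : x < 0 := hx
    split_ifs with h
    · rw [mem_graphLine, fullFun_of_nonpos h hx.le]
      ring_nf
    · simp [leftLog, rightFun, margin_of_le (not_lt.1 h), hx]

/-- The chart of the nonvertical lines meeting the `y`-axis. -/
noncomputable def fullChart : LineChart where
  dom := univ
  slopes := Ioo (-1) 1
  fn := fullFun
  line := graphLine
  isOpen_dom := isOpen_univ
  ordConnected_dom := ordConnected_univ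
  isOpen_slopes := isOpen_Ioo
  continuousOn_fn := continuousOn_fullFun
  strictMonoOn_sub _ _ _ _ h := fullFun_sub_strictMonoOn h
  monotoneOn_or s hs := by
    have hs := abs_lt.2 hs
    rcases le_total 0 s with h | h
    · exact Or.inl ((fullFun_monotone hs h).monotoneOn _)
    · right
      have := ((fullFun_monotone (by rwa [abs_neg]) (neg_nonneg.2 h)).monotoneOn univ).neg
      refine this.congr fun x _ => ?_
      simp
  line_mem s hs c := graphLine_mem (abs_lt.2 hs) _
  mem_line s _ c x _ y := Iff.rfl

/-- All lines are vertical or in a chart whose domain is the projection of the line. -/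
theorem exists_chart_of_mem {L : Set (ℝ × ℝ)} (hL : L ∈ specialLines) :
    (∃ c, L = vertical c) ∨ ∃ C : LineChart, ∃ s ∈ C.slopes, ∃ c, L = C.line s c ∧
      ∀ p ∈ L, p.1 ∈ C.dom := by
  rcases hL with ⟨c, rfl⟩ | ⟨l, c, hl, rfl | rfl⟩ | ⟨s, t, hs, rfl⟩
  · exact Or.inl ⟨c, rfl⟩
  · refine Or.inr ⟨rightChart, l, mem_univ _, c, ?_, fun p hp => hp.1⟩
    simp [rightChart, not_lt.2 hl]
  · refine Or.inr ⟨leftChart, -l, mem_univ _, c, ?_, fun p hp => hp.1⟩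
    simp [leftChart, not_lt.2 hl]
  · exact Or.inr ⟨fullChart, s, abs_lt.1 hs, t, rfl, fun p _ => mem_univ _⟩

theorem rightChart_surj {L : Set (ℝ × ℝ)} (hL : L ∈ specialLines) (hv : ∀ c, L ≠ vertical c)
    {p : ℝ × ℝ} (hp : p ∈ L) (h0 : 0 < p.1) : ∃ s ∈ rightChart.slopes, ∃ c,
      L = rightChart.line s c := by
  rcases hL with ⟨c, rfl⟩ | ⟨l, c, hl, rfl | rfl⟩ | ⟨s, t, hs, rfl⟩
  · exact (hv c rfl).elim
  · exact ⟨l, mem_univ _, c, by simp [rightChart, not_lt.2 hl]⟩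
  · exact absurd hp.1 h0.not_gt
  · exact ⟨s, mem_univ _, t - s * Real.log (margin s), by simp [rightChart, hs]⟩

theorem leftChart_surj {L : Set (ℝ × ℝ)} (hL : L ∈ specialLines) (hv : ∀ c, L ≠ vertical c)
    {p : ℝ × ℝ} (hp : p ∈ L) (h0 : p.1 < 0) : ∃ s ∈ leftChart.slopes, ∃ c,
      L = leftChart.line s c := by
  rcases hL with ⟨c, rfl⟩ | ⟨l, c, hl, rfl | rfl⟩ | ⟨s, t, hs, rfl⟩
  · exact (hv c rfl).elim
  · exact absurd hp.1 h0.not_gt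
  · exact ⟨-l, mem_univ _, c, by simp [leftChart, not_lt.2 hl]⟩
  · exact ⟨s, mem_univ _, t + s * Real.log (margin s), by simp [leftChart, hs]⟩

theorem fullChart_surj {L : Set (ℝ × ℝ)} (hL : L ∈ specialLines) (hv : ∀ c, L ≠ vertical c)
    {p q : ℝ × ℝ} (hp : p ∈ L) (hq : q ∈ L) (hp0 : p.1 ≤ 0) (hq0 : 0 ≤ q.1) :
    ∃ s ∈ fullChart.slopes, ∃ c, L = fullChart.line s c := by
  rcases hL with ⟨c, rfl⟩ | ⟨l, c, hl, rfl | rfl⟩ | ⟨s, t, hs, rfl⟩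
  · exact (hv c rfl).elim
  · exact absurd hp.1 hp0.not_gt
  · exact absurd hq.1 hq0.not_gt
  · exact ⟨s, abs_lt.1 hs, t, rfl⟩

/-- The full chart is enough at abscissa `0`, because no log curve reaches the axis. -/
theorem exists_chart_at (x : ℝ) : ∃ C : LineChart, x ∈ C.dom ∧ ∀ L ∈ specialLines,
    (∀ c, L ≠ vertical c) → ∀ y, (x, y) ∈ L → ∃ s ∈ C.slopes, ∃ c, L = C.line s c := by
  rcases lt_trichotomy x 0 with h | h | h
  · exact ⟨leftChart, h, fun L hL hv y hy => leftChart_surj hL hv hy h⟩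
  · exact ⟨fullChart, mem_univ _, fun L hL hv y hy => fullChart_surj hL hv hy hy h.le h.ge⟩
  · exact ⟨rightChart, h, fun L hL hv y hy => rightChart_surj hL hv hy h⟩

/-- Strict monotonicity of the increment determines the slope, and one point then determines the
intercept. -/
theorem LineChart.eq_of_mem (C : LineChart) {s s' c c' : ℝ} (hs : s ∈ C.slopes)
    (hs' : s' ∈ C.slopes) {p q : ℝ × ℝ} (hp : p.1 ∈ C.dom) (hq : q.1 ∈ C.dom) (hpq : p.1 ≠ q.1)
    (h₁ : p ∈ C.line s c) (h₂ : q ∈ C.line s c) (h₁' : p ∈ C.line s' c')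
    (h₂' : q ∈ C.line s' c') : s = s' ∧ c = c' := by
  wlog h : p.1 < q.1 generalizing p q
  · exact this hq hp hpq.symm h₂ h₁ h₂' h₁' (lt_of_le_of_ne (not_lt.1 h) hpq.symm)
  have e₁ := (C.mem_line s hs c _ hp p.2).1 h₁
  have e₂ := (C.mem_line s hs c _ hq q.2).1 h₂
  have e₁' := (C.mem_line s' hs' c' _ hp p.2).1 h₁'
  have e₂' := (C.mem_line s' hs' c' _ hq q.2).1 h₂'
  have := (C.strictMonoOn_sub _ hp _ hq h).injOn hs hs' (show _ - _ = _ - _ by linarith)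
  subst this
  exact ⟨rfl, by linarith⟩

/-- A chart containing all lines through any pair of points with given distinct abscissae. -/
theorem exists_chart_pair {x₁ x₂ : ℝ} (h : x₁ < x₂) : ∃ C : LineChart, x₁ ∈ C.dom ∧ x₂ ∈ C.dom ∧
    (∀ L ∈ specialLines, ∀ y₁ y₂, (x₁, y₁) ∈ L → (x₂, y₂) ∈ L →
      ∃ s ∈ C.slopes, ∃ c, L = C.line s c) ∧
    ∀ d, ∃ s ∈ C.slopes, C.fn s x₂ - C.fn s x₁ = d := by
  have hv : ∀ {L : Set (ℝ × ℝ)} {y₁ y₂}, (x₁, y₁) ∈ L → (x₂, y₂) ∈ L → ∀ c, L ≠ vertical c := by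
    rintro L y₁ y₂ h1 h2 c rfl
    have h1 : x₁ = c := h1
    have h2 : x₂ = c := h2
    linarith
  rcases lt_or_ge 0 x₁ with h1 | h1
  · refine ⟨rightChart, h1, h1.trans h, fun L hL y₁ y₂ hy₁ hy₂ =>
      rightChart_surj hL (hv hy₁ hy₂) hy₁ h1, fun d => ?_⟩
    obtain ⟨s, hs⟩ := exists_rightFun_sub_eq h1 h d
    exact ⟨s, mem_univ _, hs⟩
  rcases lt_or_ge x₂ 0 with h2 | h2
  · refine ⟨leftChart, h.trans h2, h2, fun L hL y₁ y₂ hy₁ hy₂ =>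
      leftChart_surj hL (hv hy₁ hy₂) hy₂ h2, fun d => ?_⟩
    obtain ⟨s, hs⟩ := exists_rightFun_sub_eq (neg_pos.2 h2) (neg_lt_neg h) d
    exact ⟨s, mem_univ _, by simp only [leftChart]; linarith⟩
  · refine ⟨fullChart, mem_univ _, mem_univ _, fun L hL y₁ y₂ hy₁ hy₂ =>
      fullChart_surj hL (hv hy₁ hy₂) hy₁ hy₂ h1 h2, fun d => ?_⟩
    obtain ⟨s, hs, hd⟩ := exists_fullFun_sub_eq h1 h2 h d
    exact ⟨s, abs_lt.1 hs, hd⟩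

theorem eq_vertical_of_mem {L : Set (ℝ × ℝ)} (hL : L ∈ specialLines) {p q : ℝ × ℝ} (hpq : p ≠ q)
    (h : p.1 = q.1) (hp : p ∈ L) (hq : q ∈ L) : L = vertical p.1 := by
  rcases exists_chart_of_mem hL with ⟨c, rfl⟩ | ⟨C, s, hs, c, rfl, hdom⟩
  · rw [show p.1 = c from hp]
  · refine (hpq (Prod.ext h ?_)).elim
    rw [(C.mem_line s hs c _ (hdom p hp) p.2).1 hp, (C.mem_line s hs c _ (hdom q hq) q.2).1 hq, h]

/-- Two points are joined by a unique line. -/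
theorem existsUnique_line {p q : ℝ × ℝ} (hpq : p ≠ q) :
    ∃! L : Set (ℝ × ℝ), L ∈ specialLines ∧ p ∈ L ∧ q ∈ L := by
  rcases eq_or_ne p.1 q.1 with h | h
  · refine ⟨vertical p.1, ⟨vertical_mem _, rfl, h.symm⟩, ?_⟩
    rintro L ⟨hL, hp, hq⟩
    exact eq_vertical_of_mem hL hpq h hp hq
  wlog hlt : p.1 < q.1 generalizing p q
  · have := this hpq.symm h.symm (lt_of_le_of_ne (not_lt.1 hlt) h.symm)
    simpa only [and_comm (a := q ∈ _)] using this
  obtain ⟨C, hp, hq, hall, hex⟩ := exists_chart_pair hlt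
  obtain ⟨s, hs, hd⟩ := hex (q.2 - p.2)
  have hpL : p ∈ C.line s (p.2 - C.fn s p.1) := (C.mem_line s hs _ _ hp p.2).2 (by ring)
  have hqL : q ∈ C.line s (p.2 - C.fn s p.1) := (C.mem_line s hs _ _ hq q.2).2 (by linarith)
  refine ⟨_, ⟨C.line_mem s hs _, hpL, hqL⟩, ?_⟩
  rintro L ⟨hL, hpL', hqL'⟩
  obtain ⟨s', hs', c', rfl⟩ := hall L hL p.2 q.2 hpL' hqL'
  obtain ⟨rfl, rfl⟩ := C.eq_of_mem hs hs' hp hq h hpL hqL hpL' hqL'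
  rfl

theorem line_eq_of_mem {K L : Set (ℝ × ℝ)} (hK : K ∈ specialLines) (hL : L ∈ specialLines)
    {p q : ℝ × ℝ} (hpq : p ≠ q) (hpK : p ∈ K) (hqK : q ∈ K) (hpL : p ∈ L) (hqL : q ∈ L) : K = L :=
  (existsUnique_line hpq).unique ⟨hK, hpK, hqK⟩ ⟨hL, hpL, hqL⟩

/-! ### Openness of noncollinearity -/

theorem LineChart.continuousAt_fn (C : LineChart) {X : Type*} [TopologicalSpace X] {u v : X → ℝ}
    {z : X} (hu : ContinuousAt u z) (hv : ContinuousAt v z) (hs : u z ∈ C.slopes)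
    (hx : v z ∈ C.dom) : ContinuousAt (fun z => C.fn (u z) (v z)) z := by
  have h : ContinuousAt (fun z : ℝ × ℝ => C.fn z.1 z.2) (u z, v z) :=
    C.continuousOn_fn.continuousAt ((C.isOpen_slopes.prod C.isOpen_dom).mem_nhds ⟨hs, hx⟩)
  exact ContinuousAt.comp (g := fun z : ℝ × ℝ => C.fn z.1 z.2) (f := fun z => (u z, v z)) h
    (hu.prodMk hv)

theorem LineChart.continuousOn_fn_right (C : LineChart) {s : ℝ} (hs : s ∈ C.slopes) :
    ContinuousOn (C.fn s) C.dom :=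
  C.continuousOn_fn.comp (f := fun x => (s, x)) (by fun_prop) fun _ hx => ⟨hs, hx⟩

theorem LineChart.continuousOn_fn_left (C : LineChart) {x : ℝ} (hx : x ∈ C.dom) :
    ContinuousOn (fun s => C.fn s x) C.slopes :=
  C.continuousOn_fn.comp (f := fun s => (s, x)) (by fun_prop) fun _ hs => ⟨hs, hx⟩

/-- Evaluation of the defining equation of a line depends continuously on the line and the
point. -/
theorem LineChart.continuousAt_eqn (C : LineChart) {s c : ℝ} {a : ℝ × ℝ} (hs : s ∈ C.slopes)
    (ha : a.1 ∈ C.dom) :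
    ContinuousAt (fun z : (ℝ × ℝ) × (ℝ × ℝ) => z.2.2 - (C.fn z.1.1 z.2.1 + z.1.2)) ((s, c), a) := by
  have h : ContinuousAt (fun z : (ℝ × ℝ) × (ℝ × ℝ) => C.fn z.1.1 z.2.1) ((s, c), a) :=
    C.continuousAt_fn (by fun_prop) (by fun_prop) hs ha
  have h2 : ContinuousAt (fun z : (ℝ × ℝ) × (ℝ × ℝ) => z.2.2) ((s, c), a) := by fun_prop
  have h3 : ContinuousAt (fun z : (ℝ × ℝ) × (ℝ × ℝ) => z.1.2) ((s, c), a) := by fun_prop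
  exact h2.sub (h.add h3)

/-- The parameters of a line depend continuously on two of its points. -/
theorem LineChart.eventually_line (C : LineChart) {s₀ c₀ : ℝ} (hs₀ : s₀ ∈ C.slopes)
    {a b : ℝ × ℝ} (ha : a.1 ∈ C.dom) (hb : b.1 ∈ C.dom) (hab : a.1 ≠ b.1)
    (haL : a ∈ C.line s₀ c₀) (hbL : b ∈ C.line s₀ c₀) {W : Set (ℝ × ℝ)} (hW : W ∈ 𝓝 (s₀, c₀)) :
    ∀ᶠ z : (ℝ × ℝ) × (ℝ × ℝ) in 𝓝 (a, b), ∀ L ∈ specialLines, z.1 ∈ L → z.2 ∈ L →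
      ∃ s ∈ C.slopes, ∃ c, (s, c) ∈ W ∧ L = C.line s c := by
  wlog h : a.1 < b.1 generalizing a b
  · have := this hb ha hab.symm hbL haL (lt_of_le_of_ne (not_lt.1 h) hab.symm)
    filter_upwards [(continuous_swap.tendsto (a, b)).eventually this] with z hz L hL h1 h2
    exact hz L hL h2 h1
  have haL := (C.mem_line s₀ hs₀ c₀ _ ha a.2).1 haL
  have hbL := (C.mem_line s₀ hs₀ c₀ _ hb b.2).1 hbL
  have hcont : ContinuousAt (fun z : ℝ × (ℝ × ℝ) => (z.1, z.2.2 - C.fn z.1 z.2.1)) (s₀, a) := by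
    have h1 : ContinuousAt (fun z : ℝ × (ℝ × ℝ) => C.fn z.1 z.2.1) (s₀, a) :=
      C.continuousAt_fn (by fun_prop) (by fun_prop) hs₀ ha
    have h2 : ContinuousAt (fun z : ℝ × (ℝ × ℝ) => z.2.2) (s₀, a) := by fun_prop
    exact continuousAt_fst.prodMk (h2.sub h1)
  have hW' : W ∈ 𝓝 (s₀, a.2 - C.fn s₀ a.1) := by
    rwa [show a.2 - C.fn s₀ a.1 = c₀ by linarith]
  have hpre := hcont.preimage_mem_nhds hW'
  rw [mem_nhds_prod_iff] at hpre
  obtain ⟨S, hS, T, hT, hST⟩ := hpre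
  obtain ⟨ε, hε, hball⟩ := Metric.nhds_basis_closedBall.mem_iff.1
    (Filter.inter_mem hS (C.isOpen_slopes.mem_nhds hs₀))
  rw [Real.closedBall_eq_Icc] at hball
  have hm : s₀ - ε ∈ C.slopes := (hball ⟨le_rfl, by linarith⟩).2
  have hp : s₀ + ε ∈ C.slopes := (hball ⟨by linarith, le_rfl⟩).2
  have hcf : ∀ s ∈ C.slopes, ContinuousAt
      (fun z : (ℝ × ℝ) × (ℝ × ℝ) => C.fn s z.2.1 - C.fn s z.1.1) (a, b) := by
    intro s hs
    have h1 : ContinuousAt (fun z : (ℝ × ℝ) × (ℝ × ℝ) => C.fn s z.2.1) (a, b) :=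
      C.continuousAt_fn (by fun_prop) (by fun_prop) hs hb
    have h2 : ContinuousAt (fun z : (ℝ × ℝ) × (ℝ × ℝ) => C.fn s z.1.1) (a, b) :=
      C.continuousAt_fn (by fun_prop) (by fun_prop) hs ha
    exact h1.sub h2
  have hcd : ContinuousAt (fun z : (ℝ × ℝ) × (ℝ × ℝ) => z.2.2 - z.1.2) (a, b) := by fun_prop
  -- The rises for the slopes `s₀ - ε` and `s₀ + ε` strictly bracket the required rise at `(a, b)`,
  -- hence also nearby. The intermediate value theorem then finds the joining line with slope in
  -- between.
  have em := (hcf _ hm).eventually_lt hcd (by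
    have : _ - _ < _ - _ := C.strictMonoOn_sub _ ha _ hb h hm hs₀ (by linarith)
    simp only
    linarith)
  have ep := hcd.eventually_lt (hcf _ hp) (by
    have : _ - _ < _ - _ := C.strictMonoOn_sub _ ha _ hb h hs₀ hp (by linarith)
    simp only
    linarith)
  have h11 : ContinuousAt (fun z : (ℝ × ℝ) × (ℝ × ℝ) => z.1.1) (a, b) := by fun_prop
  have h21 : ContinuousAt (fun z : (ℝ × ℝ) × (ℝ × ℝ) => z.2.1) (a, b) := by fun_prop
  filter_upwards [em, ep, h11.eventually_lt h21 h, h11 (C.isOpen_dom.mem_nhds ha),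
    h21 (C.isOpen_dom.mem_nhds hb), continuousAt_fst hT] with z hzm hzp hlt hz1 hz2 hzT L hL h1 h2
  obtain ⟨s, hs, hsz⟩ := intermediate_value_Icc (by linarith : s₀ - ε ≤ s₀ + ε)
    (((C.continuousOn_fn_left hz2).sub (C.continuousOn_fn_left hz1)).mono
      fun s hs => (hball hs).2) ⟨hzm.le, hzp.le⟩
  have hsC := (hball hs).2
  refine ⟨s, hsC, z.1.2 - C.fn s z.1.1, hST (mk_mem_prod (hball hs).1 hzT), ?_⟩
  have hsz : C.fn s z.2.1 - C.fn s z.1.1 = z.2.2 - z.1.2 := hsz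
  exact line_eq_of_mem hL (C.line_mem s hsC _) (fun h => hlt.ne (congrArg Prod.fst h)) h1 h2
    ((C.mem_line s hsC _ _ hz1 z.1.2).2 (by ring)) ((C.mem_line s hsC _ _ hz2 z.2.2).2 (by linarith))

/-- Three points are collinear if some line contains them. -/
def OnLine (p q r : ℝ × ℝ) : Prop := ∃ L ∈ specialLines, p ∈ L ∧ q ∈ L ∧ r ∈ L

theorem OnLine.swap {p q r : ℝ × ℝ} (h : OnLine p q r) : OnLine p r q := by
  obtain ⟨L, hL, hp, hq, hr⟩ := h
  exact ⟨L, hL, hp, hr, hq⟩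

/-- The defining equation of the line is violated at `r`, and this persists when its parameters and
`r` move slightly. -/
theorem LineChart.eventually_not_onLine (C : LineChart) {s c : ℝ} (hs : s ∈ C.slopes)
    {p q r : ℝ × ℝ} (hp : p.1 ∈ C.dom) (hq : q.1 ∈ C.dom) (hr : r.1 ∈ C.dom) (hpq : p.1 ≠ q.1)
    (hpL : p ∈ C.line s c) (hqL : q ∈ C.line s c) (hrL : r ∉ C.line s c) :
    ∀ᶠ z : ((ℝ × ℝ) × (ℝ × ℝ)) × (ℝ × ℝ) in 𝓝 ((p, q), r), ¬ OnLine z.1.1 z.1.2 z.2 := by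
  have hne : r.2 - (C.fn s r.1 + c) ≠ 0 := fun h =>
    hrL ((C.mem_line s hs c _ hr r.2).2 (by linarith))
  have hev := (C.continuousAt_eqn (c := c) hs hr).eventually_ne hne
  obtain ⟨W, hW, N, hN, hWN⟩ := mem_nhds_prod_iff.1 hev
  have h1 := C.eventually_line hs hp hq hpq hpL hqL hW
  have h2 : ∀ᶠ r' in 𝓝 r, r' ∈ N ∧ r'.1 ∈ C.dom :=
    Filter.Eventually.and hN (continuousAt_fst (C.isOpen_dom.mem_nhds hr))
  rw [nhds_prod_eq]
  filter_upwards [h1.prod_mk h2]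
  rintro ⟨⟨p', q'⟩, r'⟩ ⟨h1, hN', hr'⟩ ⟨L, hL, hpL, hqL, hrL⟩
  obtain ⟨s', hs', c', hW', rfl⟩ := h1 L hL hpL hqL
  refine hWN (mk_mem_prod hW' hN') ?_
  have := (C.mem_line s' hs' c' _ hr' r'.2).1 hrL
  simp only
  linarith

/-- Noncollinearity is an open condition. -/
theorem eventually_not_onLine {p q r : ℝ × ℝ} (h : ¬ OnLine p q r) :
    ∀ᶠ z : ((ℝ × ℝ) × (ℝ × ℝ)) × (ℝ × ℝ) in 𝓝 ((p, q), r), ¬ OnLine z.1.1 z.1.2 z.2 := by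
  -- These are configurations in which one chart serves: all three points strictly on one side, or
  -- `p` and `q` weakly separated by the axis. All others reduce to them by exchanging `q` and `r`.
  have base : ∀ {p q r : ℝ × ℝ}, ¬ OnLine p q r → p.1 ≠ q.1 →
      (0 < p.1 ∧ 0 < q.1 ∧ 0 < r.1 ∨ p.1 < 0 ∧ q.1 < 0 ∧ r.1 < 0 ∨ p.1 ≤ 0 ∧ 0 ≤ q.1 ∨
        q.1 ≤ 0 ∧ 0 ≤ p.1) →
      ∀ᶠ z : ((ℝ × ℝ) × (ℝ × ℝ)) × (ℝ × ℝ) in 𝓝 ((p, q), r), ¬ OnLine z.1.1 z.1.2 z.2 := by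
    intro p q r h hpq hcases
    obtain ⟨L, ⟨hL, hpL, hqL⟩, -⟩ := existsUnique_line (fun h => hpq (congrArg Prod.fst h))
    have hrL : r ∉ L := fun hr => h ⟨L, hL, hpL, hqL, hr⟩
    have hv : ∀ c, L ≠ vertical c := by
      rintro c rfl
      exact hpq ((show p.1 = c from hpL).trans (show q.1 = c from hqL).symm)
    rcases hcases with ⟨hp, hq, hr⟩ | ⟨hp, hq, hr⟩ | ⟨hp, hq⟩ | ⟨hq, hp⟩
    · obtain ⟨s, hs, c, rfl⟩ := rightChart_surj hL hv hpL hp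
      exact rightChart.eventually_not_onLine hs hp hq hr hpq hpL hqL hrL
    · obtain ⟨s, hs, c, rfl⟩ := leftChart_surj hL hv hpL hp
      exact leftChart.eventually_not_onLine hs hp hq hr hpq hpL hqL hrL
    · obtain ⟨s, hs, c, rfl⟩ := fullChart_surj hL hv hpL hqL hp hq
      exact fullChart.eventually_not_onLine hs (mem_univ _) (mem_univ _) (mem_univ _) hpq hpL hqL hrL
    · obtain ⟨s, hs, c, rfl⟩ := fullChart_surj hL hv hqL hpL hq hp
      exact fullChart.eventually_not_onLine hs (mem_univ _) (mem_univ _) (mem_univ _) hpq hpL hqL hrL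
  have swap : (∀ᶠ z : ((ℝ × ℝ) × (ℝ × ℝ)) × (ℝ × ℝ) in 𝓝 ((p, r), q), ¬ OnLine z.1.1 z.1.2 z.2) →
      ∀ᶠ z : ((ℝ × ℝ) × (ℝ × ℝ)) × (ℝ × ℝ) in 𝓝 ((p, q), r), ¬ OnLine z.1.1 z.1.2 z.2 := by
    intro h
    have hc : Continuous fun z : ((ℝ × ℝ) × (ℝ × ℝ)) × (ℝ × ℝ) => ((z.1.1, z.2), z.1.2) := by
      fun_prop
    filter_upwards [(hc.tendsto ((p, q), r)).eventually h] with z hz hz'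
    exact hz hz'.swap
  have h' : ¬ OnLine p r q := fun h' => h h'.swap
  by_cases hpq : p.1 = q.1
  · have hpr : p.1 ≠ r.1 := fun hpr => h ⟨vertical p.1, vertical_mem _, rfl, hpq.symm, hpr.symm⟩
    refine swap (base h' hpr ?_)
    rw [← hpq]
    rcases lt_trichotomy p.1 0 with h1 | h1 | h1 <;> rcases lt_trichotomy r.1 0 with h2 | h2 | h2 <;>
      simp [h1, h2, h1.le, h2.le]
  · by_cases hsep : p.1 ≤ 0 ∧ 0 ≤ q.1 ∨ q.1 ≤ 0 ∧ 0 ≤ p.1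
    · exact base h hpq (Or.inr (Or.inr hsep))
    push Not at hsep
    rcases le_or_gt p.1 0 with h1 | h1
    · have hq := hsep.1 h1
      have hp : p.1 < 0 := by
        by_contra h0
        exact (hsep.2 hq.le).not_ge (not_lt.1 h0)
      rcases lt_or_ge r.1 0 with h2 | h2
      · exact base h hpq (Or.inr (Or.inl ⟨hp, hq, h2⟩))
      · exact swap (base h' (by linarith) (Or.inr (Or.inr (Or.inl ⟨h1, h2⟩))))
    · have hq : 0 < q.1 := by
        by_contra h0
        exact (hsep.2 (not_lt.1 h0)).not_gt h1
      rcases lt_or_ge 0 r.1 with h2 | h2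
      · exact base h hpq (Or.inl ⟨h1, hq, h2⟩)
      · exact swap (base h' (by linarith) (Or.inr (Or.inr (Or.inr ⟨h2, h1.le⟩))))

/-! ### Arcs of lines and intersections -/

/-- Arcs of lines are monotone, hence contained in the rectangle spanned by the endpoints. -/
theorem exists_mem_between {L : Set (ℝ × ℝ)} (hL : L ∈ specialLines) {a b : ℝ × ℝ} (ha : a ∈ L)
    (hb : b ∈ L) (hab : a.1 ≠ b.1) {x : ℝ} (hx : x ∈ uIcc a.1 b.1) :
    ∃ y ∈ uIcc a.2 b.2, (x, y) ∈ L := by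
  rcases exists_chart_of_mem hL with ⟨c, rfl⟩ | ⟨C, s, hs, c, rfl, hdom⟩
  · exact (hab ((show a.1 = c from ha).trans (show b.1 = c from hb).symm)).elim
  have ha' := hdom a ha
  have hb' := hdom b hb
  have hsub := C.ordConnected_dom.uIcc_subset ha' hb'
  refine ⟨C.fn s x + c, ?_, (C.mem_line s hs c x (hsub hx) _).2 rfl⟩
  rw [(C.mem_line s hs c _ ha' a.2).1 ha, (C.mem_line s hs c _ hb' b.2).1 hb]
  have : C.fn s x ∈ uIcc (C.fn s a.1) (C.fn s b.1) := by
    rcases C.monotoneOn_or s hs with h | h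
    · exact (h.mono hsub).mapsTo_uIcc hx
    · exact (h.mono hsub).mapsTo_uIcc hx
  rw [mem_uIcc] at this ⊢
  rcases this with h | h
  · left; constructor <;> linarith [h.1, h.2]
  · right; constructor <;> linarith [h.1, h.2]

/-- An arc of a line crosses every graph separating its endpoints. -/
theorem exists_crossing {L : Set (ℝ × ℝ)} (hL : L ∈ specialLines) {a b : ℝ × ℝ} (ha : a ∈ L)
    (hb : b ∈ L) {f : ℝ → ℝ} (hf : ContinuousOn f (uIcc a.1 b.1)) (hfa : f a.1 < a.2)
    (hfb : b.2 < f b.1) : ∃ r ∈ L, r.1 ∈ uIcc a.1 b.1 ∧ r.2 ∈ uIcc a.2 b.2 ∧ r.2 = f r.1 := by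
  by_cases hab : a.1 = b.1
  · have hv := eq_vertical_of_mem hL (p := a) (q := b)
      (by rintro rfl; exact (hfa.trans hfb).false) hab ha hb
    refine ⟨(a.1, f a.1), ?_, left_mem_uIcc, ?_, rfl⟩
    · rw [hv]
      exact rfl
    · rw [← hab] at hfb
      exact mem_uIcc.2 (Or.inr ⟨hfb.le, hfa.le⟩)
  · have hmem : ∀ x ∈ uIcc a.1 b.1, ∃ y ∈ uIcc a.2 b.2, (x, y) ∈ L := fun x hx =>
      exists_mem_between hL ha hb hab hx
    rcases exists_chart_of_mem hL with ⟨c, rfl⟩ | ⟨C, s, hs, c, rfl, hdom⟩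
    · exact (hab ((show a.1 = c from ha).trans (show b.1 = c from hb).symm)).elim
    have ha' := hdom a ha
    have hb' := hdom b hb
    have ea := (C.mem_line s hs c _ ha' a.2).1 ha
    have eb := (C.mem_line s hs c _ hb' b.2).1 hb
    have hsub := C.ordConnected_dom.uIcc_subset ha' hb'
    obtain ⟨x, hx, hx0⟩ := intermediate_value_uIcc
      ((((C.continuousOn_fn_right hs).mono hsub).add (continuousOn_const (c := c))).sub hf)
      (show (0 : ℝ) ∈ uIcc _ _ from mem_uIcc.2 (Or.inr
        ⟨by simp only [Pi.sub_apply, Pi.add_apply]; linarith,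
          by simp only [Pi.sub_apply, Pi.add_apply]; linarith⟩))
    obtain ⟨y, hy, hxy⟩ := hmem x hx
    refine ⟨(x, y), hxy, hx, hy, ?_⟩
    have := (C.mem_line s hs c x (hsub hx) y).1 hxy
    simp only [Pi.sub_apply, Pi.add_apply] at hx0
    simp only
    linarith

/-- A line which is not a vertical translate of `graphLine s t` meets it. -/
theorem exists_mem_inter_graphLine {L : Set (ℝ × ℝ)} (hL : L ∈ specialLines) {s : ℝ}
    (hs : |s| < 1) (h : ∀ t, L ≠ graphLine s t) (t : ℝ) : ∃ p ∈ L, p ∈ graphLine s t := by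
  rcases hL with ⟨c, rfl⟩ | ⟨l, c, hl, rfl | rfl⟩ | ⟨s', t', hs', rfl⟩
  · exact ⟨(c, fullFun s c + t), rfl, rfl⟩
  · obtain ⟨x, hx, hd⟩ := exists_mul_log_sub_fullFun_eq hl hs (t - c)
    refine ⟨(x, fullFun s x + t), ⟨hx, ?_⟩, rfl⟩
    simp only
    linarith
  · obtain ⟨x, hx, hd⟩ := exists_mul_log_sub_fullFun_eq hl (s := -s) (by rwa [abs_neg]) (t - c)
    refine ⟨(-x, fullFun s (-x) + t), ⟨by simpa using hx, ?_⟩, rfl⟩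
    simp only [neg_neg, fullFun_neg_right]
    rw [fullFun_neg_left] at hd
    linarith
  · have hne : s ≠ s' := by
      rintro rfl
      exact h t' rfl
    obtain ⟨x, hd⟩ := exists_fullFun_sub_fullFun_eq hs hs' hne (t - t')
    refine ⟨(x, fullFun s x + t), ?_, rfl⟩
    rw [mem_graphLine]
    linarith

/-! ### The topology of the line space -/

theorem isOpen_meets {U : Set (ℝ × ℝ)} (hU : IsOpen U) :
    IsOpen {L : specialPlane.lines | ((L : Set (ℝ × ℝ)) ∩ U).Nonempty} :=
  TopologicalSpace.isOpen_generateFrom_of_mem ⟨U, hU, rfl⟩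

theorem eventually_meets {L : specialPlane.lines} {p : ℝ × ℝ} (hp : p ∈ (L : Set (ℝ × ℝ)))
    {U : Set (ℝ × ℝ)} (hU : U ∈ 𝓝 p) :
    ∀ᶠ L' : specialPlane.lines in 𝓝 L, ((L' : Set (ℝ × ℝ)) ∩ U).Nonempty := by
  have h := (isOpen_meets (isOpen_interior (s := U))).mem_nhds
    (show L ∈ {L : specialPlane.lines | ((L : Set (ℝ × ℝ)) ∩ interior U).Nonempty} from
      ⟨p, hp, mem_interior_iff_mem_nhds.2 hU⟩)
  filter_upwards [h] with L' hL'
  exact hL'.mono (inter_subset_inter_right _ interior_subset)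

/-- If two points of a vertical line move, the lines joining them pass close to any third point of
the line. -/
theorem eventually_join_meets_vertical {p q r : ℝ × ℝ} (hpq : p ≠ q) (hq : q.1 = p.1)
    (hr : r.1 = p.1) {U : Set (ℝ × ℝ)} (hU : U ∈ 𝓝 r) :
    ∀ᶠ z : (ℝ × ℝ) × (ℝ × ℝ) in 𝓝 (p, q), ∀ L ∈ specialLines, z.1 ∈ L → z.2 ∈ L →
      (L ∩ U).Nonempty := by
  obtain ⟨ε, hε, hball⟩ := Metric.nhds_basis_closedBall.mem_iff.1 hU
  have hU' : ∀ x, |x - p.1| ≤ ε → (x, r.2) ∈ U := by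
    intro x hx
    apply hball
    rw [Metric.mem_closedBall, Prod.dist_eq]
    simp only [dist_self, Real.dist_eq, hr]
    exact max_le hx hε.le
  have hne : p.2 ≠ q.2 := fun h => hpq (Prod.ext hq.symm h)
  -- The segments over `p.1 - ε` and `p.1 + ε` with heights in `I` are barriers: by compactness, all
  -- lines joining points near `p` and `q` miss them.
  set I := Icc (min q.2 r.2 - 1) (max q.2 r.2 + 1) with hI
  have hmiss : ∀ x, x ≠ p.1 → ∀ᶠ z : (ℝ × ℝ) × (ℝ × ℝ) in 𝓝 (p, q), ∀ k ∈ ({x} ×ˢ I : Set (ℝ × ℝ)),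
      ¬ OnLine z.1 z.2 k := by
    intro x hx
    refine (isCompact_singleton.prod isCompact_Icc).eventually_forall_of_forall_eventually ?_
    rintro k ⟨hk, -⟩
    refine eventually_not_onLine ?_
    rintro ⟨L, hL, hpL, hqL, hkL⟩
    rw [eq_vertical_of_mem hL hpq hq.symm hpL hqL] at hkL
    exact hx ((show k.1 = x from hk).symm.trans hkL)
  have h12 : ContinuousAt (fun z : (ℝ × ℝ) × (ℝ × ℝ) => z.1.2) (p, q) := by fun_prop
  have h21 : ContinuousAt (fun z : (ℝ × ℝ) × (ℝ × ℝ) => z.2.1) (p, q) := by fun_prop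
  have h22 : ContinuousAt (fun z : (ℝ × ℝ) × (ℝ × ℝ) => z.2.2) (p, q) := by fun_prop
  have e22 : ∀ᶠ z : (ℝ × ℝ) × (ℝ × ℝ) in 𝓝 (p, q), z.2.2 ∈ Ioo (q.2 - 1) (q.2 + 1) :=
    h22 (Ioo_mem_nhds (by simp) (by simp))
  have e21 : ∀ᶠ z : (ℝ × ℝ) × (ℝ × ℝ) in 𝓝 (p, q), z.2.1 ∈ Ioo (p.1 - ε) (p.1 + ε) :=
    h21 (Ioo_mem_nhds (by simp [hq, hε]) (by simp [hq, hε]))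
  have ene : ∀ᶠ z : (ℝ × ℝ) × (ℝ × ℝ) in 𝓝 (p, q), z.1.2 - z.2.2 ≠ 0 :=
    (h12.sub h22).eventually_ne (sub_ne_zero.2 hne)
  filter_upwards [hmiss (p.1 - ε) (by linarith), hmiss (p.1 + ε) (by linarith), e22, e21, ene]
    with z hzm hzp hz22 hz21 hzne L hL h1 h2
  have hnp : ∀ t, L ≠ graphLine 0 t := by
    rintro t rfl
    rw [← Prod.mk.eta (p := z.1), mem_graphLine] at h1
    rw [← Prod.mk.eta (p := z.2), mem_graphLine] at h2
    simp only [fullFun_zero_left] at h1 h2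
    exact hzne (by linarith)
  -- A line that is not horizontal meets the horizontal line at height `r.2`. By monotonicity its
  -- arc from `z.2` to this point keeps its heights in `I`, so it cannot leave the strip without
  -- hitting a barrier.
  obtain ⟨⟨x, y⟩, hxL, hxy⟩ := exists_mem_inter_graphLine hL (s := 0) (by simp) hnp r.2
  have hy : y = r.2 := by
    rw [mem_graphLine] at hxy
    simpa using hxy
  subst hy
  have hcross : ∀ x', x' ∈ uIcc z.2.1 x → z.2.1 ≠ x →
      (∀ k ∈ ({x'} ×ˢ I : Set (ℝ × ℝ)), ¬ OnLine z.1 z.2 k) → False := by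
    intro x' hx' hzx hmiss
    obtain ⟨y, hy, hyL⟩ := exists_mem_between hL h2 hxL hzx hx'
    refine hmiss (x', y) ⟨rfl, ?_⟩ ⟨L, hL, h1, h2, hyL⟩
    have hsub : uIcc z.2.2 r.2 ⊆ I := by
      apply ordConnected_Icc.uIcc_subset
      · exact ⟨by linarith [min_le_left q.2 r.2, hz22.1], by linarith [le_max_left q.2 r.2, hz22.2]⟩
      · exact ⟨by linarith [min_le_right q.2 r.2], by linarith [le_max_right q.2 r.2]⟩
    exact hsub hy
  refine ⟨(x, r.2), hxL, hU' x (abs_le.2 ⟨?_, ?_⟩)⟩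
  · by_contra hlt
    exact hcross (p.1 - ε) (mem_uIcc.2 (Or.inr ⟨by linarith, hz21.1.le⟩)) (by linarith [hz21.1]) hzm
  · by_contra hlt
    exact hcross (p.1 + ε) (mem_uIcc.2 (Or.inl ⟨hz21.2.le, by linarith⟩)) (by linarith [hz21.2]) hzp

/-- If two points of a line move, the lines joining them pass close to any third point of the
line. -/
theorem eventually_join_meets {L : Set (ℝ × ℝ)} (hL : L ∈ specialLines) {p q r : ℝ × ℝ}
    (hpq : p ≠ q) (hp : p ∈ L) (hq : q ∈ L) (hr : r ∈ L) {U : Set (ℝ × ℝ)} (hU : U ∈ 𝓝 r) :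
    ∀ᶠ z : (ℝ × ℝ) × (ℝ × ℝ) in 𝓝 (p, q), ∀ L ∈ specialLines, z.1 ∈ L → z.2 ∈ L →
      (L ∩ U).Nonempty := by
  rcases exists_chart_of_mem hL with ⟨c, rfl⟩ | ⟨C, s, hs, c, rfl, hdom⟩
  · exact eventually_join_meets_vertical hpq ((show q.1 = c from hq).trans (show p.1 = c from hp).symm)
      ((show r.1 = c from hr).trans (show p.1 = c from hp).symm) hU
  have hp' := hdom p hp
  have hq' := hdom q hq
  have hr' := hdom r hr
  have hne : p.1 ≠ q.1 := by
    intro h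
    refine hpq (Prod.ext h ?_)
    rw [(C.mem_line s hs c _ hp' p.2).1 hp, (C.mem_line s hs c _ hq' q.2).1 hq, h]
  have hc : ContinuousAt (fun z : ℝ × ℝ => (r.1, C.fn z.1 r.1 + z.2)) (s, c) :=
    continuousAt_const.prodMk
      ((C.continuousAt_fn (u := fun z : ℝ × ℝ => z.1) (v := fun _ => r.1) (by fun_prop)
        (by fun_prop) hs hr').add continuousAt_snd)
  have hU' : U ∈ 𝓝 (r.1, C.fn s r.1 + c) := by
    rwa [← (C.mem_line s hs c _ hr' r.2).1 hr]
  filter_upwards [C.eventually_line hs hp' hq' hne hp hq (hc hU')] with z hz L hL h1 h2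
  obtain ⟨s', hs', c', hU', rfl⟩ := hz L hL h1 h2
  exact ⟨_, (C.mem_line s' hs' c' _ hr' _).2 rfl, hU'⟩

/-- The line joining two points. -/
noncomputable def join (x : DistinctPairs (ℝ × ℝ)) : specialPlane.lines :=
  ⟨(existsUnique_line x.2).choose, (existsUnique_line x.2).choose_spec.1.1⟩

theorem left_mem_join (x : DistinctPairs (ℝ × ℝ)) : x.1.1 ∈ (join x : Set (ℝ × ℝ)) :=
  (existsUnique_line x.2).choose_spec.1.2.1

theorem right_mem_join (x : DistinctPairs (ℝ × ℝ)) : x.1.2 ∈ (join x : Set (ℝ × ℝ)) :=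
  (existsUnique_line x.2).choose_spec.1.2.2

theorem join_eq {x : DistinctPairs (ℝ × ℝ)} {L : specialPlane.lines}
    (h₁ : x.1.1 ∈ (L : Set (ℝ × ℝ))) (h₂ : x.1.2 ∈ (L : Set (ℝ × ℝ))) : join x = L :=
  Subtype.ext (line_eq_of_mem (join x).2 L.2 x.2 (left_mem_join x) (right_mem_join x) h₁ h₂)

theorem continuous_join : Continuous join := by
  refine continuous_generateFrom_iff.2 ?_
  rintro _ ⟨U, hU, rfl⟩
  rw [isOpen_iff_mem_nhds]
  rintro x ⟨r, hr, hrU⟩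
  have h := eventually_join_meets (join x).2 x.2 (left_mem_join x) (right_mem_join x) hr
    (hU.mem_nhds hrU)
  filter_upwards [continuous_subtype_val.continuousAt (x := x) h] with z hz
  exact hz _ (join z).2 (left_mem_join z) (right_mem_join z)

theorem exists_pair_mem {L : Set (ℝ × ℝ)} (hL : L ∈ specialLines) :
    ∃ p ∈ L, ∃ q ∈ L, p ≠ q := by
  rcases hL with ⟨c, rfl⟩ | ⟨l, c, hl, rfl | rfl⟩ | ⟨s, t, hs, rfl⟩
  · exact ⟨(c, 0), rfl, (c, 1), rfl, by simp⟩
  · exact ⟨(1, l * Real.log 1 + c), ⟨by norm_num, rfl⟩, (2, l * Real.log 2 + c),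
      ⟨by norm_num, rfl⟩, by simp⟩
  · exact ⟨(-1, l * Real.log (-(-1)) + c), ⟨by norm_num, rfl⟩, (-2, l * Real.log (-(-2)) + c),
      ⟨by norm_num, rfl⟩, by simp⟩
  · exact ⟨(0, fullFun s 0 + t), rfl, (1, fullFun s 1 + t), rfl, by simp⟩

/-- A line near `join x` meets given disjoint neighbourhoods of both points of `x`; a point chosen
in each gives a pair near `x` with that line as its join. -/
theorem isOpenMap_join : IsOpenMap join := by
  rw [isOpenMap_iff_nhds_le]
  intro x V hV
  rw [Filter.mem_map, nhds_subtype_eq_comap, Filter.mem_comap] at hV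
  obtain ⟨T, hT, hTV⟩ := hV
  obtain ⟨U₁, hU₁, U₂, hU₂, hU⟩ := mem_nhds_prod_iff.1 hT
  obtain ⟨V₁, V₂, hV₁, hV₂, h1, h2, hd⟩ := t2_separation x.2
  filter_upwards [eventually_meets (left_mem_join x) (Filter.inter_mem hU₁ (hV₁.mem_nhds h1)),
    eventually_meets (right_mem_join x) (Filter.inter_mem hU₂ (hV₂.mem_nhds h2))]
  rintro L ⟨p, hpL, hpU, hpV⟩ ⟨q, hqL, hqU, hqV⟩
  have hpq : p ≠ q := by
    rintro rfl
    exact Set.disjoint_left.1 hd hpV hqV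
  have h := hTV (show (⟨(p, q), hpq⟩ : DistinctPairs (ℝ × ℝ)) ∈ Subtype.val ⁻¹' T from hU ⟨hpU, hqU⟩)
  rwa [mem_preimage, join_eq (L := L) hpL hqL] at h

theorem isOpenQuotientMap_join : IsOpenQuotientMap join := by
  refine ⟨fun L => ?_, continuous_join, isOpenMap_join⟩
  obtain ⟨p, hp, q, hq, hpq⟩ := exists_pair_mem L.2
  exact ⟨⟨(p, q), hpq⟩, join_eq hp hq⟩

/-- For an open quotient map this says that equality of joins is a closed relation. If two joins
differ, a point of one pair is off the line of the other, and noncollinearity is open. -/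
instance : T2Space specialPlane.lines := by
  rw [t2Space_iff_of_isOpenQuotientMap isOpenQuotientMap_join, ← isOpen_compl_iff,
    isOpen_iff_mem_nhds]
  rintro ⟨x, y⟩ hxy
  have hxy : join x ≠ join y := hxy
  have hmem : y.1.1 ∉ (join x : Set (ℝ × ℝ)) ∨ y.1.2 ∉ (join x : Set (ℝ × ℝ)) := by
    by_contra! h
    exact hxy (join_eq h.1 h.2).symm
  have hcol : ∀ r, r ∉ (join x : Set (ℝ × ℝ)) → ¬ OnLine x.1.1 x.1.2 r := by
    rintro r hr ⟨L, hL, h1, h2, h3⟩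
    have := join_eq (L := ⟨L, hL⟩) h1 h2
    rw [this] at hr
    exact hr h3
  rcases hmem with h | h
  · have hc : Continuous fun z : DistinctPairs (ℝ × ℝ) × DistinctPairs (ℝ × ℝ) =>
        (z.1.1, z.2.1.1) := by fun_prop
    filter_upwards [(hc.tendsto (x, y)).eventually (eventually_not_onLine (hcol _ h))]
    rintro ⟨x', y'⟩ hz heq
    have heq : join x' = join y' := heq
    exact hz ⟨_, (join x').2, left_mem_join _, right_mem_join _, heq ▸ left_mem_join y'⟩
  · have hc : Continuous fun z : DistinctPairs (ℝ × ℝ) × DistinctPairs (ℝ × ℝ) =>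
        (z.1.1, z.2.1.2) := by fun_prop
    filter_upwards [(hc.tendsto (x, y)).eventually (eventually_not_onLine (hcol _ h))]
    rintro ⟨x', y'⟩ hz heq
    have heq : join x' = join y' := heq
    exact hz ⟨_, (join x').2, left_mem_join _, right_mem_join _, heq ▸ right_mem_join y'⟩

instance : LocallyCompactSpace specialPlane.lines := by
  have : IsOpen {x : (ℝ × ℝ) × (ℝ × ℝ) | x.1 ≠ x.2} := isOpen_ne_fun continuous_fst continuous_snd
  have : LocallyCompactSpace (DistinctPairs (ℝ × ℝ)) := this.locallyCompactSpace
  exact isOpenQuotientMap_join.locallyCompactSpace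

/-- A space containing a nonconstant path has positive dimension. -/
theorem smallInductiveDimension_pos_of_path {X : Type u} [TopologicalSpace X] [T1Space X]
    {f : ℝ → X} (hf : Continuous f) {a b : ℝ} (hab : f a ≠ f b) :
    0 < smallInductiveDimension X := by
  by_contra h
  have h0 : smallInductiveDimension X ≤ ((0 : ℕ) : WithBot ℕ∞) := by
    simpa using h
  have hbasis := hasSmallInductiveDimensionLT_one_iff.1 (smallInductiveDimension_le_iff.1 h0)
  obtain ⟨s, hs, has, hsb⟩ := hbasis.exists_subset_of_mem_open
    (show f a ∈ ({f b}ᶜ : Set X) from hab) isOpen_compl_singleton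
  have hclopen : IsClopen (f ⁻¹' s) := hs.preimage hf
  rcases isClopen_iff.1 hclopen with h | h
  · exact (h ▸ has : a ∈ (∅ : Set ℝ))
  · exact hsb (h ▸ mem_univ b : b ∈ f ⁻¹' s) rfl

theorem isLocallyCompactPosDim_points : IsLocallyCompactPosDim (ℝ × ℝ) :=
  ⟨inferInstance, inferInstance,
    smallInductiveDimension_pos_of_path (f := fun t => (t, 0)) (by fun_prop) (a := 0) (b := 1)
      (by simp)⟩

theorem isLocallyCompactPosDim_lines : IsLocallyCompactPosDim specialPlane.lines := by
  refine ⟨inferInstance, inferInstance, ?_⟩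
  refine smallInductiveDimension_pos_of_path
    (f := fun t : ℝ => join ⟨((t, 0), (t, 1)), by simp⟩)
    (continuous_join.comp (by fun_prop)) (a := 0) (b := 1) ?_
  intro h
  have hv : ∀ t : ℝ, join ⟨((t, 0), (t, 1)), by simp⟩ = ⟨vertical t, vertical_mem t⟩ := fun t =>
    join_eq (x := ⟨((t, 0), (t, 1)), _⟩) (L := ⟨vertical t, vertical_mem t⟩)
      (show t = t from rfl) (show t = t from rfl)
  have h := congrArg Subtype.val ((hv 0).symm.trans (h.trans (hv 1)))
  have h0 : ((0 : ℝ), (0 : ℝ)) ∈ vertical 1 := by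
    rw [← show vertical 0 = vertical 1 from h]
    exact rfl
  exact zero_ne_one (α := ℝ) h0

/-! ### Stability of intersection -/

/-- A line through a point of a nonvertical line `L`, but different from `L`, has points on both
sides of `L` close to the point of intersection. -/
theorem exists_separated {K : Set (ℝ × ℝ)} (hK : K ∈ specialLines) {r : ℝ × ℝ} (hr : r ∈ K)
    {C : LineChart} (hrC : r.1 ∈ C.dom) (hC : ∀ L ∈ specialLines, (∀ c, L ≠ vertical c) →
      ∀ y, (r.1, y) ∈ L → ∃ s ∈ C.slopes, ∃ c, L = C.line s c) {s c : ℝ} (hs : s ∈ C.slopes)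
    (hrL : r ∈ C.line s c) (hne : K ≠ C.line s c) {U : Set (ℝ × ℝ)} (hU : U ∈ 𝓝 r) :
    ∃ a ∈ K ∩ U, ∃ b ∈ K ∩ U, C.fn s a.1 + c < a.2 ∧ b.2 < C.fn s b.1 + c := by
  have er := (C.mem_line s hs c _ hrC r.2).1 hrL
  by_cases hv : ∀ c, K ≠ vertical c
  swap
  · push Not at hv
    obtain ⟨d, rfl⟩ := hv
    have hc : ContinuousAt (fun y : ℝ => (r.1, y)) r.2 := by fun_prop
    obtain ⟨ε, hε, hball⟩ := Metric.nhds_basis_closedBall.mem_iff.1 (hc hU)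
    rw [Real.closedBall_eq_Icc] at hball
    exact ⟨(r.1, r.2 + ε), ⟨hr, hball ⟨by linarith, le_rfl⟩⟩, (r.1, r.2 - ε),
      ⟨hr, hball ⟨le_rfl, by linarith⟩⟩, by simp only; linarith, by simp only; linarith⟩
  obtain ⟨s', hs', c', rfl⟩ := hC K hK hv r.2 hr
  have er' := (C.mem_line s' hs' c' _ hrC r.2).1 hr
  have hss : s ≠ s' := by
    rintro rfl
    exact hne (by rw [show c' = c by linarith])
  have hc : ContinuousAt (fun x => (x, C.fn s' x + c')) r.1 :=
    continuousAt_id.prodMk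
      ((C.continuousAt_fn (u := fun _ : ℝ => s') (v := fun x => x) (by fun_prop) (by fun_prop)
        hs' hrC).add continuousAt_const)
  have hU' : U ∈ 𝓝 (r.1, C.fn s' r.1 + c') := by rwa [← er']
  obtain ⟨ε, hε, hball⟩ := Metric.nhds_basis_closedBall.mem_iff.1
    (Filter.inter_mem (hc hU') (C.isOpen_dom.mem_nhds hrC))
  rw [Real.closedBall_eq_Icc] at hball
  have hp := hball (show r.1 + ε ∈ Icc _ _ from ⟨by linarith, le_rfl⟩)
  have hm := hball (show r.1 - ε ∈ Icc _ _ from ⟨le_rfl, by linarith⟩)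
  have mp := (C.mem_line s' hs' c' _ hp.2 _).2 rfl
  have mm := (C.mem_line s' hs' c' _ hm.2 _).2 rfl
  -- The height difference of the two lines vanishes at `r.1` and is strictly monotone in the
  -- abscissa, so it has opposite signs on the two sides.
  have sp := C.strictMonoOn_sub _ hrC _ hp.2 (by linarith)
  have sm := C.strictMonoOn_sub _ hm.2 _ hrC (by linarith)
  rcases lt_or_gt_of_ne hss with h | h
  · have h1 : _ - _ < _ - _ := sp hs hs' h
    have h2 : _ - _ < _ - _ := sm hs hs' h
    exact ⟨_, ⟨mp, hp.1⟩, _, ⟨mm, hm.1⟩, by simp only; linarith, by simp only; linarith⟩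
  · have h1 : _ - _ < _ - _ := sp hs' hs h
    have h2 : _ - _ < _ - _ := sm hs' hs h
    exact ⟨_, ⟨mm, hm.1⟩, _, ⟨mp, hp.1⟩, by simp only; linarith, by simp only; linarith⟩

/-- Lines close to a nonvertical line have parameters close to those of the line. -/
theorem LineChart.eventually_eq_line (C : LineChart) {s c : ℝ} (hs : s ∈ C.slopes) {r : ℝ × ℝ}
    (hrC : r.1 ∈ C.dom) {L : specialPlane.lines} (hL : (L : Set (ℝ × ℝ)) = C.line s c)
    {W : Set (ℝ × ℝ)} (hW : W ∈ 𝓝 (s, c)) : ∀ᶠ L' : specialPlane.lines in 𝓝 L,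
      ∃ s' ∈ C.slopes, ∃ c', (s', c') ∈ W ∧ (L' : Set (ℝ × ℝ)) = C.line s' c' := by
  obtain ⟨ε, hε, hball⟩ := Metric.nhds_basis_closedBall.mem_iff.1 (C.isOpen_dom.mem_nhds hrC)
  rw [Real.closedBall_eq_Icc] at hball
  have hp : r.1 + ε ∈ C.dom := hball ⟨by linarith, le_rfl⟩
  have mr := (C.mem_line s hs c _ hrC _).2 rfl
  have mp := (C.mem_line s hs c _ hp _).2 rfl
  have hne : r.1 ≠ r.1 + ε := by linarith
  have hev := C.eventually_line hs (a := (r.1, C.fn s r.1 + c))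
    (b := (r.1 + ε, C.fn s (r.1 + ε) + c)) hrC hp hne mr mp hW
  rw [nhds_prod_eq, Filter.eventually_prod_iff] at hev
  obtain ⟨P, hP, Q, hQ, hPQ⟩ := hev
  filter_upwards [eventually_meets (L := L) (hL ▸ mr) hP, eventually_meets (L := L) (hL ▸ mp) hQ]
  rintro L' ⟨p, hpL, hp⟩ ⟨q, hqL, hq⟩
  exact hPQ hp hq L' L'.2 hpL hqL

/-- Lines close to two given intersecting lines intersect close to the point of intersection. -/
theorem eventually_inter {K L : specialPlane.lines} (hKL : K ≠ L) {r : ℝ × ℝ}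
    (hrK : r ∈ (K : Set (ℝ × ℝ))) (hrL : r ∈ (L : Set (ℝ × ℝ))) {U : Set (ℝ × ℝ)} (hU : U ∈ 𝓝 r) :
    ∀ᶠ x : specialPlane.lines × specialPlane.lines in 𝓝 (K, L),
      ∃ p ∈ U, p ∈ (x.1 : Set (ℝ × ℝ)) ∧ p ∈ (x.2 : Set (ℝ × ℝ)) := by
  wlog hv : ∀ c, (L : Set (ℝ × ℝ)) ≠ vertical c generalizing K L
  · push Not at hv
    obtain ⟨c, hc⟩ := hv
    have hKv : ∀ c, (K : Set (ℝ × ℝ)) ≠ vertical c := by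
      intro c' hc'
      refine hKL (Subtype.ext ?_)
      rw [hc] at hrL
      rw [hc'] at hrK
      rw [hc, hc', ← (show r.1 = c from hrL), ← (show r.1 = c' from hrK)]
    filter_upwards [(continuous_swap.tendsto (K, L)).eventually (this hKL.symm hrL hrK hKv)]
    rintro x ⟨p, hp, h1, h2⟩
    exact ⟨p, hp, h2, h1⟩
  obtain ⟨C, hrC, hC⟩ := exists_chart_at r.1
  obtain ⟨s, hs, c, hL⟩ := hC L L.2 hv r.2 hrL
  have hdom : ContinuousAt (fun p : ℝ × ℝ => p.1) r := continuousAt_fst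
  obtain ⟨ε, hε, hball⟩ := Metric.nhds_basis_closedBall.mem_iff.1
    (Filter.inter_mem hU (hdom (C.isOpen_dom.mem_nhds hrC)))
  have hbox : Metric.closedBall r ε = Icc (r.1 - ε) (r.1 + ε) ×ˢ Icc (r.2 - ε) (r.2 + ε) := by
    rw [← Real.closedBall_eq_Icc, ← Real.closedBall_eq_Icc, closedBall_prod_same]
  -- Points of `K` on both sides of `L` persist for nearby lines, so the arc of `K'` between them
  -- crosses `L'`. Arcs are monotone, which keeps the crossing in the box.
  obtain ⟨a, ⟨haK, haB⟩, b, ⟨hbK, hbB⟩, ha, hb⟩ := exists_separated K.2 hrK hrC hC hs (hL ▸ hrL)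
    (fun h => hKL (Subtype.ext (h.trans hL.symm))) (Metric.ball_mem_nhds r hε)
  have haC : a.1 ∈ C.dom := (hball (Metric.ball_subset_closedBall haB)).2
  have hbC : b.1 ∈ C.dom := (hball (Metric.ball_subset_closedBall hbB)).2
  have eva := continuousAt_const.eventually_lt (C.continuousAt_eqn (c := c) hs haC)
    (show (0 : ℝ) < _ by simp only; linarith)
  have evb := (C.continuousAt_eqn (c := c) hs hbC).eventually_lt continuousAt_const
    (show _ < (0 : ℝ) by simp only; linarith)
  obtain ⟨W₁, hW₁, A, hA, hWA⟩ := mem_nhds_prod_iff.1 eva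
  obtain ⟨W₂, hW₂, B, hB, hWB⟩ := mem_nhds_prod_iff.1 evb
  have hballa := Metric.isOpen_ball.mem_nhds haB
  have hballb := Metric.isOpen_ball.mem_nhds hbB
  rw [nhds_prod_eq]
  filter_upwards [((eventually_meets haK (Filter.inter_mem hA hballa)).and
    (eventually_meets hbK (Filter.inter_mem hB hballb))).prod_mk
    (C.eventually_eq_line hs hrC hL (Filter.inter_mem hW₁ hW₂))]
  rintro ⟨K', L'⟩ ⟨⟨⟨a', haK', haA', haB'⟩, ⟨b', hbK', hbA', hbB'⟩⟩, s', hs', c', hW', hL'⟩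
  have ha' : 0 < a'.2 - (C.fn s' a'.1 + c') := hWA (mk_mem_prod hW'.1 haA')
  have hb' : b'.2 - (C.fn s' b'.1 + c') < 0 := hWB (mk_mem_prod hW'.2 hbA')
  have haB' := Metric.ball_subset_closedBall haB'
  have hbB' := Metric.ball_subset_closedBall hbB'
  have hsub := C.ordConnected_dom.uIcc_subset (hball haB').2 (hball hbB').2
  rw [hbox] at haB' hbB'
  obtain ⟨p, hpK, hp1, hp2, hp⟩ := exists_crossing K'.2 haK' hbK'
    (f := fun x => C.fn s' x + c')
    (((C.continuousOn_fn_right hs').mono hsub).add continuousOn_const)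
    (by linarith) (by linarith)
  refine ⟨p, ?_, hpK, ?_⟩
  · refine (hball ?_).1
    rw [hbox]
    exact ⟨ordConnected_Icc.uIcc_subset haB'.1 hbB'.1 hp1,
      ordConnected_Icc.uIcc_subset haB'.2 hbB'.2 hp2⟩
  · show p ∈ (L' : Set (ℝ × ℝ))
    rw [hL']
    exact (C.mem_line s' hs' c' _ (hsub hp1) p.2).2 hp

theorem isOpen_meetDomain : IsOpen specialPlane.meetDomain := by
  rw [isOpen_iff_mem_nhds]
  rintro ⟨K, L⟩ ⟨hKL, r, hrK, hrL⟩
  have hne : IsOpen {x : specialPlane.lines × specialPlane.lines | x.1 ≠ x.2} :=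
    isOpen_ne_fun continuous_fst continuous_snd
  filter_upwards [hne.mem_nhds (show (K, L) ∈ {x : specialPlane.lines × specialPlane.lines |
    x.1 ≠ x.2} from hKL), eventually_inter hKL hrK hrL Filter.univ_mem]
  rintro x hx ⟨p, -, hp⟩
  exact ⟨hx, p, hp⟩

theorem exists_continuous_meet : ∃ m : specialPlane.meetDomain → ℝ × ℝ, Continuous m ∧
    ∀ x, m x ∈ (x.1.1 : Set (ℝ × ℝ)) ∧ m x ∈ (x.1.2 : Set (ℝ × ℝ)) := by
  choose m hm using fun x : specialPlane.meetDomain => x.2.2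
  refine ⟨m, ?_, hm⟩
  rw [continuous_iff_continuousAt]
  intro x U hU
  rw [Filter.mem_map]
  have h := eventually_inter x.2.1 (hm x).1 (hm x).2 hU
  filter_upwards [continuous_subtype_val.continuousAt (x := x) h]
  rintro y ⟨p, hpU, hp1, hp2⟩
  have : m y = p := by
    by_contra hne
    exact y.2.1 (Subtype.ext (line_eq_of_mem y.1.1.2 y.1.2.2 hne (hm y).1 hp1 (hm y).2 hp2))
  exact mem_preimage.2 (this ▸ hpU)

theorem exists_quadrangle : ∃ a : Fin 4 → ℝ × ℝ, Function.Injective a ∧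
    ∀ i j k : Fin 4, i ≠ j → j ≠ k → i ≠ k →
      ∀ L ∈ specialPlane.lines, ¬ (a i ∈ L ∧ a j ∈ L ∧ a k ∈ L) := by
  have key : ∀ L ∈ specialLines, ∀ p q r : ℝ × ℝ, p ≠ q → p.1 = q.1 → p.1 ≠ r.1 →
      p ∈ L → q ∈ L → r ∉ L := by
    intro L hL p q r hpq h hr hp hq hrL
    rw [eq_vertical_of_mem hL hpq h hp hq] at hrL
    exact hr (show r.1 = p.1 from hrL).symm
  -- The corners of the unit square: among any three, exactly two share an abscissa, and their join
  -- is vertical.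
  have hinj : Function.Injective fun i : Fin 4 =>
      (((i.val / 2 : ℕ) : ℝ), ((i.val % 2 : ℕ) : ℝ)) := by
    intro i j h
    simp only [Prod.mk.injEq, Nat.cast_inj] at h
    omega
  refine ⟨_, hinj, ?_⟩
  rintro i j k hij hjk hik L hL ⟨hi, hj, hk⟩
  have h1 := fun h h' => key L hL _ _ _ (hinj.ne hij) h h' hi hj hk
  have h2 := fun h h' => key L hL _ _ _ (hinj.ne hik) h h' hi hk hj
  have h3 := fun h h' => key L hL _ _ _ (hinj.ne hjk) h h' hj hk hi
  simp only [ne_eq, Nat.cast_inj] at h1 h2 h3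
  have hcases : (i.val / 2 = j.val / 2 ∧ i.val / 2 ≠ k.val / 2) ∨
      (i.val / 2 = k.val / 2 ∧ i.val / 2 ≠ j.val / 2) ∨
      (j.val / 2 = k.val / 2 ∧ j.val / 2 ≠ i.val / 2) := by omega
  rcases hcases with h | h | h
  · exact h1 h.1 h.2
  · exact h2 h.1 h.2
  · exact h3 h.1 h.2

theorem isStablePlane_specialPlane : specialPlane.IsStablePlane where
  nontrivial_of_mem _ hL := exists_pair_mem hL
  existsUnique_line _ _ hpq := existsUnique_line hpq
  points_top := isLocallyCompactPosDim_points
  lines_top := isLocallyCompactPosDim_lines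
  continuous_join := ⟨join, continuous_join, fun x => ⟨left_mem_join x, right_mem_join x⟩⟩
  continuous_meet := exists_continuous_meet
  isOpen_meetDomain := isOpen_meetDomain
  exists_quadrangle := exists_quadrangle

/-! ### The special properties -/

theorem homeomorph_real {L : Set (ℝ × ℝ)} (hL : L ∈ specialLines) : Nonempty (L ≃ₜ ℝ) := by
  rcases hL with ⟨c, rfl⟩ | ⟨l, c, hl, rfl | rfl⟩ | ⟨s, t, hs, rfl⟩
  · exact ⟨{
      toFun := fun p => p.1.2
      invFun := fun y => ⟨(c, y), rfl⟩
      left_inv := fun p => Subtype.ext (Prod.ext p.2.symm rfl)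
      right_inv := fun y => rfl
      continuous_toFun := by fun_prop
      continuous_invFun := by fun_prop }⟩
  · exact ⟨{
      toFun := fun p => Real.log p.1.1
      invFun := fun u => ⟨(Real.exp u, l * u + c), Real.exp_pos u, by simp⟩
      left_inv := fun p => Subtype.ext (Prod.ext (Real.exp_log p.2.1) p.2.2.symm)
      right_inv := fun y => Real.log_exp y
      continuous_toFun := Continuous.log (by fun_prop) fun p => p.2.1.ne'
      continuous_invFun := by fun_prop }⟩
  · exact ⟨{
      toFun := fun p => Real.log (-p.1.1)
      invFun := fun u => ⟨(-Real.exp u, l * u + c), neg_lt_zero.2 (Real.exp_pos u), by simp⟩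
      left_inv := fun p => Subtype.ext (Prod.ext
        (neg_eq_iff_eq_neg.2 (Real.exp_log (neg_pos.2 p.2.1))) p.2.2.symm)
      right_inv := fun y => by simp
      continuous_toFun := Continuous.log (by fun_prop) fun p => (neg_pos.2 p.2.1).ne'
      continuous_invFun := by fun_prop }⟩
  · have := continuous_fullFun hs
    exact ⟨{
      toFun := fun p => p.1.1
      invFun := fun x => ⟨(x, fullFun s x + t), rfl⟩
      left_inv := fun p => Subtype.ext (Prod.ext rfl p.2.symm)
      right_inv := fun y => rfl
      continuous_toFun := by fun_prop
      continuous_invFun := by fun_prop }⟩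

theorem eq_graphLine_of_inter_yAxis {L : Set (ℝ × ℝ)} (hL : L ∈ specialLines) (h : L ≠ yAxis)
    (hn : (L ∩ yAxis).Nonempty) : ∃ s t, |s| < 1 ∧ L = graphLine s t := by
  obtain ⟨p, hpL, hp⟩ := hn
  have hp : p.1 = 0 := hp
  rcases hL with ⟨c, rfl⟩ | ⟨l, c, hl, rfl | rfl⟩ | hL
  · rw [← show p.1 = c from hpL, hp] at h
    exact (h rfl).elim
  · exact absurd hp hpL.1.ne'
  · exact absurd hp hpL.1.ne
  · exact hL

theorem disjoint_graphLine {s t t' : ℝ} (h : t ≠ t') :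
    Disjoint (graphLine s t) (graphLine s t') := by
  rw [Set.disjoint_left]
  rintro ⟨x, y⟩ h1 h2
  rw [mem_graphLine] at h1 h2
  exact h (by linarith)

/-- This is the source of affinity, biaffinity and the description of parallels: growth forces every
line that is not a vertical translate to meet the graph line. -/
theorem disjoint_graphLine_iff {L : Set (ℝ × ℝ)} (hL : L ∈ specialLines) {s t : ℝ} (hs : |s| < 1) :
    Disjoint L (graphLine s t) ↔ ∃ t', t' ≠ t ∧ L = graphLine s t' := by
  constructor
  · intro hd
    by_contra! h
    by_cases h' : ∃ t', L = graphLine s t'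
    · obtain ⟨t', rfl⟩ := h'
      have : t' = t := by
        by_contra hne
        exact h t' hne rfl
      subst this
      exact Set.disjoint_left.1 hd (show ((0 : ℝ), fullFun s 0 + t') ∈ _ from rfl) rfl
    · push Not at h'
      obtain ⟨p, hp, hp'⟩ := exists_mem_inter_graphLine hL hs h' t
      exact Set.disjoint_left.1 hd hp hp'
  · rintro ⟨t', ht, rfl⟩
    exact disjoint_graphLine ht

theorem isAffineLine_graphLine {s : ℝ} (hs : |s| < 1) (t : ℝ) :
    specialPlane.IsAffineLine (graphLine s t) := by
  refine ⟨graphLine_mem hs t, fun p hp => ?_⟩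
  have hne : p.2 - fullFun s p.1 ≠ t := by
    intro h
    exact hp (mem_graphLine.2 (by linarith : p.2 = fullFun s p.1 + t))
  refine ⟨graphLine s (p.2 - fullFun s p.1), ⟨graphLine_mem hs _, ?_, disjoint_graphLine hne⟩, ?_⟩
  · exact mem_graphLine.2 (by ring : p.2 = fullFun s p.1 + (p.2 - fullFun s p.1))
  · rintro L ⟨hL, hpL, hd⟩
    obtain ⟨t', ht', rfl⟩ := (disjoint_graphLine_iff hL hs).1 hd
    have : p.2 = fullFun s p.1 + t' := hpL
    rw [show t' = p.2 - fullFun s p.1 by linarith]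

/-- A line in the closed right half plane has several disjoint lines through a point in the left
half plane. -/
theorem not_isAffineLine_of_nonneg {L : Set (ℝ × ℝ)} (h : ∀ p ∈ L, 0 ≤ p.1) :
    ¬ specialPlane.IsAffineLine L := by
  rintro ⟨-, ha⟩
  have hd : ∀ K : Set (ℝ × ℝ), (∀ p ∈ K, ¬ 0 ≤ p.1) → Disjoint K L := fun K hK =>
    Set.disjoint_left.2 fun p hpK hpL => hK p hpK (h p hpL)
  have hp : ((-1 : ℝ), (0 : ℝ)) ∉ L := fun hp => by
    have := h _ hp
    norm_num at this
  have heq : vertical (-1) = leftLog 1 0 := (ha _ hp).unique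
    ⟨vertical_mem _, rfl, hd _ fun p hp => by rw [show p.1 = -1 from hp]; norm_num⟩
    ⟨leftLog_mem (by simp) _, by simp [leftLog], hd _ fun p hp => not_le.2 hp.1⟩
  have : ((-1 : ℝ), (1 : ℝ)) ∈ leftLog 1 0 := heq ▸ rfl
  simp [leftLog] at this

/-- A line in the closed left half plane has several disjoint lines through a point in the right
half plane. -/
theorem not_isAffineLine_of_nonpos {L : Set (ℝ × ℝ)} (h : ∀ p ∈ L, p.1 ≤ 0) :
    ¬ specialPlane.IsAffineLine L := by
  rintro ⟨-, ha⟩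
  have hd : ∀ K : Set (ℝ × ℝ), (∀ p ∈ K, ¬ p.1 ≤ 0) → Disjoint K L := fun K hK =>
    Set.disjoint_left.2 fun p hpK hpL => hK p hpK (h p hpL)
  have hp : ((1 : ℝ), (0 : ℝ)) ∉ L := fun hp => by
    have := h _ hp
    norm_num at this
  have heq : vertical 1 = rightLog 1 0 := (ha _ hp).unique
    ⟨vertical_mem _, rfl, hd _ fun p hp => by rw [show p.1 = 1 from hp]; norm_num⟩
    ⟨rightLog_mem (by simp) _, by simp [rightLog], hd _ fun p hp => not_le.2 hp.1⟩
  have : ((1 : ℝ), (1 : ℝ)) ∈ rightLog 1 0 := heq ▸ rfl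
  simp [rightLog] at this

theorem eq_graphLine_of_isAffineLine {L : Set (ℝ × ℝ)} (h : specialPlane.IsAffineLine L) :
    ∃ s t, |s| < 1 ∧ L = graphLine s t := by
  have hpos : ¬ ∀ p ∈ L, 0 ≤ p.1 := fun h' => not_isAffineLine_of_nonneg h' h
  have hneg : ¬ ∀ p ∈ L, p.1 ≤ 0 := fun h' => not_isAffineLine_of_nonpos h' h
  rcases h.1 with ⟨c, rfl⟩ | ⟨l, c, hl, rfl | rfl⟩ | hL
  · rcases le_total 0 c with hc | hc
    · exact (hpos fun p hp => hc.trans_eq (show p.1 = c from hp).symm).elim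
    · exact (hneg fun p hp => (show p.1 = c from hp).trans_le hc).elim
  · exact (hpos fun p hp => hp.1.le).elim
  · exact (hneg fun p hp => hp.1.le).elim
  · exact hL

theorem graphLine_ne_yAxis (s t : ℝ) : graphLine s t ≠ yAxis := by
  intro h
  have h1 : ((1 : ℝ), fullFun s 1 + t) ∈ graphLine s t := rfl
  rw [h] at h1
  exact one_ne_zero (α := ℝ) h1

theorem graphLine_inter_yAxis (s t : ℝ) : (graphLine s t ∩ yAxis).Nonempty :=
  ⟨(0, fullFun s 0 + t), rfl, rfl⟩

theorem vTranslate_graphLine (s t u : ℝ) : vTranslate u (graphLine s t) = graphLine s (t + u) := by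
  ext ⟨x, y⟩
  simp only [vTranslate, mem_image, mem_graphLine, Prod.exists, Prod.mk.injEq]
  constructor
  · rintro ⟨x', y', h, rfl, rfl⟩
    linarith
  · intro h
    exact ⟨x, y - u, by linarith, rfl, by ring⟩

theorem parallel_graphLine_iff {s t : ℝ} (hs : |s| < 1) {K : Set (ℝ × ℝ)} :
    K ∈ specialLines ∧ Parallel K (graphLine s t) ↔ ∃ t', K = graphLine s t' := by
  constructor
  · rintro ⟨hK, rfl | hd⟩
    · exact ⟨t, rfl⟩
    · obtain ⟨t', -, h⟩ := (disjoint_graphLine_iff hK hs).1 hd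
      exact ⟨t', h⟩
  · rintro ⟨t', rfl⟩
    refine ⟨graphLine_mem hs t', ?_⟩
    by_cases h : t' = t
    · exact Or.inl (by rw [h])
    · exact Or.inr (disjoint_graphLine h)

theorem isSpecial_specialPlane : IsSpecial specialPlane where
  isStablePlane := isStablePlane_specialPlane
  homeomorph_real _ hL := homeomorph_real hL
  yAxis_mem := vertical_mem 0
  exists_second_type := by
    refine ⟨vertical 1, vertical_mem 1, Set.disjoint_left.2 fun p h1 h0 => ?_⟩
    exact one_ne_zero (α := ℝ) ((show p.1 = 1 from h1).symm.trans h0)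
  exists_third_type := ⟨graphLine 0 0, graphLine_mem (by simp) 0, graphLine_ne_yAxis 0 0,
    graphLine_inter_yAxis 0 0⟩
  affine_iff L hL := by
    constructor
    · intro h
      obtain ⟨s, t, -, rfl⟩ := eq_graphLine_of_isAffineLine h
      exact ⟨graphLine_ne_yAxis s t, graphLine_inter_yAxis s t⟩
    · rintro ⟨h, hn⟩
      obtain ⟨s, t, hs, rfl⟩ := eq_graphLine_of_inter_yAxis hL h hn
      exact isAffineLine_graphLine hs t
  biaffine L hL h hn := by
    obtain ⟨s, t, hs, rfl⟩ := eq_graphLine_of_inter_yAxis hL h hn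
    refine ⟨isAffineLine_graphLine hs t, fun K hK hKL => ?_⟩
    obtain ⟨t', rfl⟩ := (parallel_graphLine_iff hs).1 ⟨hK, hKL⟩
    exact isAffineLine_graphLine hs t'
  parallel_iff L hL h hn K := by
    obtain ⟨s, t, hs, rfl⟩ := eq_graphLine_of_inter_yAxis hL h hn
    simp only [vTranslate_graphLine]
    refine (parallel_graphLine_iff hs).trans ⟨?_, ?_⟩
    · rintro ⟨t', rfl⟩
      exact ⟨t' - t, by rw [add_sub_cancel]⟩
    · rintro ⟨u, rfl⟩
      exact ⟨t + u, rfl⟩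

end SpecialPlane

theorem corollary2p2 :
    SpecialPlane.IsSpecial SpecialPlane.specialPlane ∧
    ¬ LineGeometry.IsProjectivelyEmbeddable.{0, v} SpecialPlane.specialPlane ∧
    ∀ G : LineGeometry (ℝ × ℝ), SpecialPlane.IsSpecial G →
      ¬ LineGeometry.IsProjectivelyEmbeddable.{0, v} G :=
  ⟨SpecialPlane.isSpecial_specialPlane,
    SpecialPlane.isSpecial_specialPlane.not_isProjectivelyEmbeddable,
    fun _ hG => hG.not_isProjectivelyEmbeddable⟩
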